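/- Let $\Omega$ be a smooth compact connected Riemannian manifold of dimension $d\ge 2$ with smooth connected (in particular non-empty) boundary $\partial\Omega$. Let $|\Omega|$ and $|\partial\Omega|$ be the Riemannian volumes of $\Omega$ and $\partial\Omega$, and let $\lambda_\Omega$, $\lambda_{\partial\Omega}$ be the corresponding normalised (probability) measures. Let $N$ be the outward unit normal on $\partial\Omega$, and let $\nabla^\tau$ be the tangential gradient on $\partial\Omega$. Let $C_\Omega$ be the (Neumann) Poincaré constant of $\Omega$, i.e. the smallest $C\in[0,\infty]$ with $$\int_\Omega f^2\,d\lambda_\Omega-\Big(\int_\Omega f\,d\lambda_\Omega\Big)^2\le C\int_\Omega|\nabla f|^2\,d\lambda_\Omega\qquad\text{for all } f\in C^1(\Omega).$$ Let $\varphi\in C^1(\Omega)$ have a Lipschitz continuous gradient $\nabla\varphi$ on $\Omega$ (so that $\Delta\varphi=\operatorname{div}\nabla\varphi$ is defined almost everywhere), and suppose that $\frac{\partial\varphi}{\partial N}$ is constant on $\partial\Omega$, equal to $1$ or equal to $-1$. Put $$K_1=\Big(\frac{|\Omega|}{|\partial\Omega|}\Big)^2\inf_{\varepsilon\in(0,\infty)}\Big[(1+\varepsilon)\,|\nabla\varphi|_2^2+(1+\varepsilon^{-1})\,C_\Omega\,|\Delta\varphi|_2^2\Big],\qquad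 K_2=0,$$ where $|\cdot|_2$ is the norm of $L^2(\Omega,\lambda_\Omega)$. Then for every $f\in C^1(\Omega)$ $$\Big(\int_\Omega f\,d\lambda_\Omega-\int_{\partial\Omega}f\,d\lambda_{\partial\Omega}\Big)^2\le K_1\int_\Omega|\nabla f|^2\,d\lambda_\Omega+K_2\int_{\partial\Omega}|\nabla^\tau f|^2\,d\lambda_{\partial\Omega}.$$ -/

import Mathlib

open Set MeasureTheory Topology
open scoped Manifold ContDiff ENNReal

noncomputable section

namespace RiemannianBoundary

/-- The coordinate space `ℝ^(n+1)`. -/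
abbrev Coord (n : ℕ) : Type := EuclideanSpace ℝ (Fin (n + 1))

/-- The point `(0, z)` of the hyperplane `{y | y 0 = 0}` bounding the model half space
`{y | 0 ≤ y 0}` of `ℝ^(n+1)`. -/
def face {n : ℕ} (z : EuclideanSpace ℝ (Fin n)) : Coord n :=
  WithLp.toLp 2 (Fin.cons (0 : ℝ) (fun i => z i))

variable {n : ℕ} {Ω : Type*} [TopologicalSpace Ω] [ChartedSpace (EuclideanHalfSpace (n + 1)) Ω]

instance finiteDimensional_tangentSpace (x : Ω) :
    FiniteDimensional ℝ (TangentSpace (𝓡∂ (n + 1)) x) :=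
  inferInstanceAs (FiniteDimensional ℝ (Coord n))

variable [IsManifold (𝓡∂ (n + 1)) ∞ Ω]

variable (n Ω) in
/-- Smooth Riemannian metrics on the smooth `(n+1)`-dimensional manifold with boundary `Ω`. -/
abbrev Metric : Type _ :=
  Bundle.ContMDiffRiemannianMetric (𝓡∂ (n + 1)) ∞ (Coord n)
    (fun x : Ω => TangentSpace (𝓡∂ (n + 1)) x)

variable (g : Metric n Ω)

/-! ### Gradient and normal derivative -/

/-- The inner product on `T_xΩ` as a bilinear form. -/
def innerForm (x : Ω) : LinearMap.BilinForm ℝ (TangentSpace (𝓡∂ (n + 1)) x) :=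
  LinearMap.mk₂ ℝ (fun v w => g.inner x v w)
    (fun v w u => by simp) (fun c v w => by simp)
    (fun v w u => by simp) (fun c v w => by simp)

@[simp] lemma innerForm_apply (x : Ω) (v w : TangentSpace (𝓡∂ (n + 1)) x) :
    innerForm g x v w = g.inner x v w := rfl

lemma innerForm_nondegenerate (x : Ω) : (innerForm g x).Nondegenerate := by
  constructor
  · intro v hv
    by_contra h
    exact (g.pos x v h).ne' (hv v)
  · intro v hv
    by_contra h
    exact (g.pos x v h).ne' (hv v)

/-- The tangent vector `α^♯` representing the covector `α`: `g(α^♯, v) = α(v)` for all `v`. -/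
def sharp (x : Ω) (α : Module.Dual ℝ (TangentSpace (𝓡∂ (n + 1)) x)) :
    TangentSpace (𝓡∂ (n + 1)) x :=
  ((innerForm g x).toDual (innerForm_nondegenerate g x)).symm α

lemma inner_sharp (x : Ω) (α : Module.Dual ℝ (TangentSpace (𝓡∂ (n + 1)) x))
    (v : TangentSpace (𝓡∂ (n + 1)) x) : g.inner x (sharp g x α) v = α v :=
  LinearMap.BilinForm.apply_toDual_symm_apply (hB := innerForm_nondegenerate g x) α v

/-- The squared length `|v|² = g(v, v)`. -/
def normSq (x : Ω) (v : TangentSpace (𝓡∂ (n + 1)) x) : ℝ := g.inner x v v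

/-- The differential of `f` at `x`, as a linear functional on `T_xΩ`. -/
def differential (f : Ω → ℝ) (x : Ω) : Module.Dual ℝ (TangentSpace (𝓡∂ (n + 1)) x) where
  toFun v := (mfderiv (𝓡∂ (n + 1)) 𝓘(ℝ, ℝ) f x v : ℝ)
  map_add' v w := (mfderiv (𝓡∂ (n + 1)) 𝓘(ℝ, ℝ) f x).map_add v w
  map_smul' c v := (mfderiv (𝓡∂ (n + 1)) 𝓘(ℝ, ℝ) f x).map_smul c v

/-- The Riemannian gradient `∇f`. -/
def grad (f : Ω → ℝ) (x : Ω) : TangentSpace (𝓡∂ (n + 1)) x :=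
  sharp g x (differential f x)

/-- The differential `v ↦ v 0` at `x` of the first coordinate of the preferred chart at `x`
(in Mathlib, `T_xΩ` is identified with `ℝ^(n+1)` through this chart). In charts `Ω` is the set
where the first coordinate is nonnegative, so for `x ∈ ∂Ω` the kernel of this functional
is `T_x∂Ω`, and it is positive exactly on the vectors that point into `Ω`. -/
def firstCoord (x : Ω) : Module.Dual ℝ (TangentSpace (𝓡∂ (n + 1)) x) :=
  ((EuclideanSpace.proj (0 : Fin (n + 1)) : Coord n →L[ℝ] ℝ) : Coord n →ₗ[ℝ] ℝ)

/-- The outward unit normal `N` at a point `x` of `∂Ω`. -/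
def outwardNormal (x : Ω) : TangentSpace (𝓡∂ (n + 1)) x :=
  -((√(normSq g x (sharp g x (firstCoord x))))⁻¹ • sharp g x (firstCoord x))

/-- The outer normal derivative `∂f/∂N` at a point `x` of `∂Ω`. -/
def normalDeriv (f : Ω → ℝ) (x : Ω) : ℝ := differential f x (outwardNormal g x)

/-- The tangential gradient `∇^τ f` at a point `x` of `∂Ω`: the orthogonal projection of `∇f`
to `T_x∂Ω`. -/
def tangentialGrad (f : Ω → ℝ) (x : Ω) : TangentSpace (𝓡∂ (n + 1)) x :=
  grad g f x - normalDeriv g f x • outwardNormal g x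

/-! ### Riemannian volume of `Ω` and of `∂Ω` -/

/-- The `i`-th coordinate vector field `∂_i` of the chart around `p`, at the point with
coordinates `y`. -/
def coordVector (p : Ω) (y : Coord n) (i : Fin (n + 1)) :
    TangentSpace (𝓡∂ (n + 1)) ((extChartAt (𝓡∂ (n + 1)) p).symm y) :=
  mfderivWithin 𝓘(ℝ, Coord n) (𝓡∂ (n + 1)) (extChartAt (𝓡∂ (n + 1)) p).symm
    (range (𝓡∂ (n + 1))) y (EuclideanSpace.single i (1 : ℝ))

/-- The Gram matrix `g_ij = g(∂_i, ∂_j)` of the metric in the chart around `p`. -/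
def gram (p : Ω) (y : Coord n) : Matrix (Fin (n + 1)) (Fin (n + 1)) ℝ :=
  Matrix.of fun i j =>
    g.inner ((extChartAt (𝓡∂ (n + 1)) p).symm y) (coordVector p y i) (coordVector p y j)

/-- The Riemannian volume density `√det (g_ij)` in the chart around `p`. -/
def density (p : Ω) (y : Coord n) : ℝ := √(gram g p y).det

/-- The volume density `√det (g_ij)_{i,j ≥ 1}` of the metric induced on `∂Ω`, in the boundary
coordinates given by the chart around `p`. -/
def boundaryDensity (p : Ω) (z : EuclideanSpace ℝ (Fin n)) : ℝ :=
  √((gram g p (face z)).submatrix Fin.succ Fin.succ).det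

/-! ### Lipschitz vector fields and the Laplacian -/

/-- The components, in the chart around `p`, of the vector field `X` at the point with
coordinates `y`. -/
def chartField (X : ∀ x : Ω, TangentSpace (𝓡∂ (n + 1)) x) (p : Ω) (y : Coord n) : Coord n :=
  mfderiv (𝓡∂ (n + 1)) 𝓘(ℝ, Coord n) (extChartAt (𝓡∂ (n + 1)) p)
    ((extChartAt (𝓡∂ (n + 1)) p).symm y) (X ((extChartAt (𝓡∂ (n + 1)) p).symm y))

/-- The vector field `X` is (locally) Lipschitz: its components in each chart are locally
Lipschitz functions, up to and including the boundary. -/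
def IsLipschitzField (X : ∀ x : Ω, TangentSpace (𝓡∂ (n + 1)) x) : Prop :=
  ∀ p : Ω, LocallyLipschitzOn (extChartAt (𝓡∂ (n + 1)) p).target (chartField X p)

/-- The Riemannian divergence `(√det g)⁻¹ ∑ i, ∂_i (√det g X^i)`, computed at `x` in the preferred
chart at `x`. For a locally Lipschitz field it has its meaning at almost every point. -/
def divergence (X : ∀ x : Ω, TangentSpace (𝓡∂ (n + 1)) x) (x : Ω) : ℝ :=
  (density g x (extChartAt (𝓡∂ (n + 1)) x x))⁻¹ *
    ∑ i : Fin (n + 1),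
      fderivWithin ℝ (fun y => density g x y * chartField X x y i) (range (𝓡∂ (n + 1)))
        (extChartAt (𝓡∂ (n + 1)) x x) (EuclideanSpace.single i (1 : ℝ))

/-- The Laplace-Beltrami operator `Δf = div ∇f`, defined almost everywhere if `∇f` is locally
Lipschitz. -/
def laplacian (f : Ω → ℝ) (x : Ω) : ℝ := divergence g (grad g f) x

variable [MeasurableSpace Ω]

/-- The restriction of the Riemannian volume to the domain of the chart around `p`. -/
def chartVolume (p : Ω) : Measure Ω :=
  Measure.map (extChartAt (𝓡∂ (n + 1)) p).symm
    ((volume.restrict (extChartAt (𝓡∂ (n + 1)) p).target).withDensity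
      fun y => ENNReal.ofReal (density g p y))

/-- The restriction of the Riemannian volume of `∂Ω` to the domain of the chart around `p`,
as a measure on `Ω`. -/
def chartBoundaryVolume (p : Ω) : Measure Ω :=
  Measure.map (fun z => (extChartAt (𝓡∂ (n + 1)) p).symm (face z))
    ((volume.restrict (face ⁻¹' (extChartAt (𝓡∂ (n + 1)) p).target)).withDensity
      fun z => ENNReal.ofReal (boundaryDensity g p z))

/-- The Riemannian volume measure of `Ω`: the smallest measure that dominates its prescribed
restriction to each chart domain. (These restrictions agree on overlaps, and countably many chart
domains cover, so this is the measure that they glue to.) -/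
def volΩ : Measure Ω := ⨆ p : Ω, chartVolume g p

/-- The `n`-dimensional Riemannian volume measure of `∂Ω`, as a measure on `Ω` carried by `∂Ω`;
glued from charts in the same way. -/
def volBdry : Measure Ω := ⨆ p : Ω, chartBoundaryVolume g p

/-- The normalised volume measure `λ_Ω`. -/
def lamΩ : Measure Ω := (volΩ g univ)⁻¹ • volΩ g

/-- The normalised boundary measure `λ_∂Ω`, as a measure on `Ω` carried by `∂Ω`. -/
def lamBdry : Measure Ω := (volBdry g univ)⁻¹ • volBdry g

/-! ### The functional inequalities -/

/-- The variance `∫ f² dμ - (∫ f dμ)²`. -/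
def Var (μ : Measure Ω) (f : Ω → ℝ) : ℝ := ∫ x, f x ^ 2 ∂μ - (∫ x, f x ∂μ) ^ 2

/-- The Dirichlet energy `∫_Ω |∇f|² dλ_Ω`; for `f = φ` also the square of the `L²(λ_Ω)`-norm
of `∇φ`. -/
def energyΩ (f : Ω → ℝ) : ℝ≥0∞ := ∫⁻ x, ENNReal.ofReal (normSq g x (grad g f x)) ∂(lamΩ g)

/-- The boundary energy `∫_∂Ω |∇^τ f|² dλ_∂Ω`. -/
def energyBdry (f : Ω → ℝ) : ℝ≥0∞ :=
  ∫⁻ x, ENNReal.ofReal (normSq g x (tangentialGrad g f x)) ∂(lamBdry g)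

/-- The squared `L²(λ_Ω)`-norm of `Δf`. -/
def laplacianSq (f : Ω → ℝ) : ℝ≥0∞ := ∫⁻ x, ENNReal.ofReal (laplacian g f x ^ 2) ∂(lamΩ g)

/-- The (Neumann) Poincaré constant `C_Ω`: the smallest `C ∈ [0, ∞]` such that
`Var_{λ_Ω}(f) ≤ C ∫_Ω |∇f|² dλ_Ω` for all `f ∈ C¹(Ω)`. -/
def poincareConst : ℝ≥0∞ :=
  sInf {C : ℝ≥0∞ | ∀ f : Ω → ℝ, ContMDiff (𝓡∂ (n + 1)) 𝓘(ℝ, ℝ) 1 f →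
    ENNReal.ofReal (Var (lamΩ g) f) ≤ C * energyΩ g f}

/-- The inequality
`(∫_Ω f dλ_Ω - ∫_∂Ω f dλ_∂Ω)² ≤ K₁ ∫_Ω |∇f|² dλ_Ω + K₂ ∫_∂Ω |∇^τ f|² dλ_∂Ω` for all `f ∈ C¹(Ω)`. -/
def MixedMeanInequality (K₁ K₂ : ℝ≥0∞) : Prop :=
  ∀ f : Ω → ℝ, ContMDiff (𝓡∂ (n + 1)) 𝓘(ℝ, ℝ) 1 f →
    ENNReal.ofReal ((∫ x, f x ∂(lamΩ g) - ∫ x, f x ∂(lamBdry g)) ^ 2) ≤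
      K₁ * energyΩ g f + K₂ * energyBdry g f

end RiemannianBoundary

end

noncomputable section

namespace RiemannianBoundary

/-! ### Lipschitz functions with compact support and the divergence theorem in a half space -/

/-! The inequality is Green's formula for `φ` followed by Cauchy–Schwarz. Let $m$ be the
$\lambda_\Omega$-mean of $f$ and $\sigma=\pm1$ the constant value of $\partial\varphi/\partial N$.
The divergence theorem for $(f-m)\nabla\varphi$ reads
$\sigma\int_{\partial\Omega}(f-m)=\int_\Omega\langle\nabla
f,\nabla\varphi\rangle+\int_\Omega(f-m)\Delta\varphi$. After normalisation the left side is $\sigma$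
times the difference of the two means, so the squared difference equals
$(|\Omega|/|\partial\Omega|)^2(A+B)^2$, where $A$ and $B$ are the $\lambda_\Omega$-means of the two
integrands on the right (`sq_sub_mean_eq`). Now
$(A+B)^2\le(1+\varepsilon)A^2+(1+\varepsilon^{-1})B^2$. Cauchy–Schwarz gives $A^2\le|\nabla
f|_2^2|\nabla\varphi|_2^2$, and with the Poincaré inequality
$B^2\le\mathrm{Var}(f)|\Delta\varphi|_2^2\le C_\Omega|\nabla f|_2^2|\Delta\varphi|_2^2$. It remains
to take the infimum over $\varepsilon$.

Most of the work is the divergence theorem (`divergenceTheorem`) for $hX$ with $X$ merely Lipschitz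
and $h$ of class $C^1$. In a half space it is Fubini together with the fundamental theorem of
calculus for Lipschitz functions on lines (`integral_lineDeriv_halfSpace`). Three facts carry it to
the manifold. The volume densities transform by Jacobian determinants, so the suprema defining the
volumes restrict to the chart measures (`restrict_iSup_eq_of_restrict_inter_eq`). The field
$\sqrt{\det g}\,X$ changes charts by the Piola transform, so the divergence, defined pointwise in a
chart that varies with the point, has the usual formula in any fixed chart (`trace_fderiv_of_piola`,
`divergence_symm`). At the boundary a change of charts preserves the first coordinate to first order
up to a positive factor, and Cramer's rule identifies the flux density with $-\sqrt{\det g}\,X^0$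
(`boundaryDensity_mul_inner_outwardNormal`). A finite partition of unity then globalises.

The constants live in $[0,\infty]$ and may be infinite. The energy of $f$ is finite by compactness;
if it vanishes, connectedness makes $f$ constant, and otherwise one may divide by it. -/

lemma exists_lipschitzWith_of_hasCompactSupport {E : Type*} [NormedAddCommGroup E] [ProperSpace E]
    {f : E → ℝ} (hf : LocallyLipschitz f) (hc : HasCompactSupport f) :
    ∃ C, LipschitzWith C f := by
  obtain ⟨R, hR⟩ := hc.isCompact.isBounded.subset_closedBall 0
  obtain ⟨K, hK⟩ := (hf.locallyLipschitzOn (s := Metric.closedBall 0 (R + 1)))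
    |>.exists_lipschitzOnWith_of_compact (isCompact_closedBall 0 (R + 1))
  obtain ⟨M, hM⟩ := hc.exists_bound_of_continuous hf.continuous
  have hM0 : 0 ≤ M := (norm_nonneg _).trans (hM 0)
  have hz : ∀ x, R < ‖x‖ → f x = 0 := fun x hx => by
    by_contra h
    have := hR (subset_tsupport f h)
    rw [mem_closedBall_zero_iff] at this
    linarith
  -- The unit collar makes a point outside the ball of radius `R + 1` at least 1 away from every
  -- point of the ball of radius `R`, so the sup bound `M` serves as a Lipschitz constant for such
  -- pairs.
  have far : ∀ x y, R + 1 < ‖y‖ → dist (f x) (f y) ≤ (max K ⟨M, hM0⟩ : NNReal) * dist x y := by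
    intro x y hy
    have hfy : f y = 0 := hz y (by linarith)
    rcases lt_or_ge R ‖x‖ with hx | hx
    · rw [hfy, hz x hx, dist_self]; positivity
    · have h1 : 1 ≤ dist x y := by
        rw [dist_comm, dist_eq_norm]
        have := norm_sub_norm_le y x
        linarith
      rw [hfy, dist_zero_right]
      calc ‖f x‖ ≤ M * 1 := by simpa using hM x
        _ ≤ (max K ⟨M, hM0⟩ : NNReal) * dist x y := by
          gcongr
          exact (le_max_right K ⟨M, hM0⟩ : (⟨M, hM0⟩ : NNReal) ≤ _)
  refine ⟨max K ⟨M, hM0⟩, LipschitzWith.of_dist_le_mul fun x y => ?_⟩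
  rcases lt_or_ge (R + 1) ‖y‖ with hy | hy
  · exact far x y hy
  rcases lt_or_ge (R + 1) ‖x‖ with hx | hx
  · rw [dist_comm, dist_comm x]; exact far y x hx
  · refine (hK.dist_le_mul x (by simpa using hx) y (by simpa using hy)).trans ?_
    gcongr
    exact le_max_left _ _

/-- A Lipschitz function is absolutely continuous on bounded intervals, so the fundamental theorem
of calculus holds for its almost everywhere defined derivative. Compact support reduces the half
line to such an interval. -/
lemma integral_Ioi_deriv_of_lipschitzWith {C : NNReal} {f : ℝ → ℝ} (hf : LipschitzWith C f)
    (hc : HasCompactSupport f) : ∫ t in Ioi (0 : ℝ), deriv f t = -f 0 := by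
  obtain ⟨R, hR⟩ := hc.isCompact.isBounded.subset_closedBall 0
  set S := max R 0 + 1 with hS
  have hS0 : 0 < S := by positivity
  have hz : ∀ t, S ≤ t → t ∉ tsupport f := fun t ht h => by
    have := hR h
    rw [mem_closedBall_zero_iff, Real.norm_eq_abs] at this
    have := le_abs_self t
    have := le_max_left R 0
    linarith
  have h1 : ∫ t in Ioc 0 S, deriv f t = ∫ t in Ioi (0 : ℝ), deriv f t := by
    refine (setIntegral_eq_of_subset_of_forall_sdiff_eq_zero measurableSet_Ioi
      Ioc_subset_Ioi_self fun t ht => ?_).symm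
    have hts : S < t := by
      by_contra h
      exact ht.2 ⟨ht.1, not_lt.1 h⟩
    have : f =ᶠ[𝓝 t] fun _ => 0 := by
      filter_upwards [(isClosed_tsupport f).isOpen_compl.mem_nhds (hz t hts.le)] with s hs
      exact image_eq_zero_of_notMem_tsupport hs
    rw [this.deriv_eq, deriv_const]
  rw [← h1, ← intervalIntegral.integral_of_le hS0.le,
    (hf.lipschitzOnWith (s := uIcc 0 S)).absolutelyContinuousOnInterval.integral_deriv_eq_sub,
    image_eq_zero_of_notMem_tsupport (hz S le_rfl), zero_sub]

variable {n : ℕ}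

/-- The point `(t, z)` of `ℝ^(n+1)`. -/
def consCoord (p : ℝ × EuclideanSpace ℝ (Fin n)) : Coord n :=
  WithLp.toLp 2 (Fin.cons p.1 (fun i => p.2 i))

@[simp] lemma consCoord_zero (p : ℝ × EuclideanSpace ℝ (Fin n)) : consCoord p 0 = p.1 := rfl

@[simp] lemma consCoord_succ (p : ℝ × EuclideanSpace ℝ (Fin n)) (i : Fin n) :
    consCoord p i.succ = p.2 i := rfl

@[simp] lemma face_zero (z : EuclideanSpace ℝ (Fin n)) : face z 0 = 0 := rfl

@[simp] lemma face_succ (z : EuclideanSpace ℝ (Fin n)) (i : Fin n) : face z i.succ = z i := rfl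

lemma coord_ext {x y : Coord n} (h0 : x 0 = y 0) (h : ∀ i : Fin n, x i.succ = y i.succ) :
    x = y := by
  ext i
  refine Fin.cases h0 h i

variable (n) in
/-- The measurable equivalence `ℝ × ℝ^n ≃ ℝ^(n+1)`. -/
def consCoordEquiv : ℝ × EuclideanSpace ℝ (Fin n) ≃ᵐ Coord n :=
  ((MeasurableEquiv.refl ℝ).prodCongr (MeasurableEquiv.toLp 2 (Fin n → ℝ)).symm).trans
    ((MeasurableEquiv.piFinSuccAbove (fun _ => ℝ) 0).symm.trans
      (MeasurableEquiv.toLp 2 (Fin (n + 1) → ℝ)))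

lemma consCoordEquiv_apply (p : ℝ × EuclideanSpace ℝ (Fin n)) :
    consCoordEquiv n p = consCoord p := by
  refine coord_ext ?_ fun i => ?_ <;>
  simp [consCoordEquiv, consCoord, MeasurableEquiv.prodCongr, MeasurableEquiv.piFinSuccAbove]

lemma measurePreserving_consCoordEquiv :
    MeasurePreserving (consCoordEquiv n) volume volume := by
  refine MeasurePreserving.trans (e := (MeasurableEquiv.refl ℝ).prodCongr
    (MeasurableEquiv.toLp 2 (Fin n → ℝ)).symm)
    (e' := (MeasurableEquiv.piFinSuccAbove (fun _ => ℝ) 0).symm.trans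
      (MeasurableEquiv.toLp 2 (Fin (n + 1) → ℝ)))
    (μb := (volume : Measure (ℝ × (Fin n → ℝ)))) ?_ ?_
  · exact (MeasurePreserving.id volume).prod (PiLp.volume_preserving_ofLp (Fin n))
  · exact ((volume_preserving_piFinSuccAbove (fun _ : Fin (n + 1) => ℝ) 0).symm).trans
      (PiLp.volume_preserving_toLp (Fin (n + 1)))

lemma integrable_lineDeriv_of_lipschitzWith {C : NNReal} {F : Coord n → ℝ} (hF : LipschitzWith C F)
    (hc : HasCompactSupport F) (v : Coord n) : Integrable fun y => lineDeriv ℝ F y v := by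
  have hsupp : Function.support (fun y => lineDeriv ℝ F y v) ⊆ tsupport F := by
    intro y hy
    by_contra h
    refine hy ?_
    have : F =ᶠ[𝓝 y] fun _ => 0 := by
      filter_upwards [(isClosed_tsupport F).isOpen_compl.mem_nhds h] with s hs
      exact image_eq_zero_of_notMem_tsupport hs
    change lineDeriv ℝ F y v = 0
    rw [this.lineDeriv_eq]
    simp [lineDeriv]
  rw [← integrableOn_iff_integrable_of_support_subset hsupp]
  refine Measure.integrableOn_of_bounded (M := C * ‖v‖) hc.isCompact.measure_lt_top.ne
    (measurable_lineDeriv hF.continuous).aestronglyMeasurable (ae_of_all _ fun y => ?_)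
  exact norm_lineDeriv_le_of_lipschitz ℝ hF

/-- Integration by parts against the constant 1. The direction `-v` absorbs the sign change of that
formula. -/
lemma integral_lineDeriv_eq_zero {E : Type*} [NormedAddCommGroup E] [NormedSpace ℝ E]
    [FiniteDimensional ℝ E] [MeasurableSpace E] [BorelSpace E] (μ : Measure E) [μ.IsAddHaarMeasure]
    {C : NNReal} {F : E → ℝ} (hF : LipschitzWith C F) (hc : HasCompactSupport F) (v : E) :
    ∫ y, lineDeriv ℝ F y v ∂μ = 0 := by
  have h := (LipschitzWith.const (1 : ℝ)).integral_lineDeriv_mul_eq (μ := μ) hF hc (-v)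
  simpa [lineDeriv] using h.symm

/-- The divergence theorem in the half space, for one component of a Lipschitz field with
compact support. -/
lemma integral_lineDeriv_halfSpace {C : NNReal} {F : Coord n → ℝ} (hF : LipschitzWith C F)
    (hc : HasCompactSupport F) (i : Fin (n + 1)) :
    ∫ y in {y : Coord n | 0 < y 0}, lineDeriv ℝ F y (EuclideanSpace.single i 1) =
      if i = 0 then -∫ z, F (face z) else 0 := by
  have hm : MeasurableSet {y : Coord n | 0 < y 0} :=
    measurableSet_lt measurable_const (by fun_prop)
  have hint := (integrable_lineDeriv_of_lipschitzWith hF hc (EuclideanSpace.single i 1)).indicator hm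
  have hcons : ∀ z : EuclideanSpace ℝ (Fin n), Isometry fun t : ℝ => consCoord (t, z) := fun z =>
    Isometry.of_dist_eq fun s t => by
      simp [EuclideanSpace.dist_eq, Fin.sum_univ_succ]
  have hcons' : ∀ t : ℝ, Isometry fun z : EuclideanSpace ℝ (Fin n) => consCoord (t, z) := fun t =>
    Isometry.of_dist_eq fun y z => by
      simp [EuclideanSpace.dist_eq, Fin.sum_univ_succ]
  rw [← integral_indicator hm, ← measurePreserving_consCoordEquiv.integral_comp']
  rw [← measurePreserving_consCoordEquiv.integrable_comp_emb
    (consCoordEquiv n).measurableEmbedding] at hint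
  simp only [Function.comp_def, consCoordEquiv_apply] at hint ⊢
  have hcomp : ∀ {G : Type} [NormedAddCommGroup G] (e : G → Coord n), Isometry e →
      LipschitzWith C (F ∘ e) := fun e he => by
    simpa using hF.comp he.lipschitz
  have hsupp : ∀ {G : Type} [NormedAddCommGroup G] [CompleteSpace G] (e : G → Coord n),
      Isometry e → HasCompactSupport (F ∘ e) := fun e he =>
    hc.comp_isClosedEmbedding he.isClosedEmbedding
  induction i using Fin.cases with
  | zero =>
    rw [Measure.volume_eq_prod] at hint ⊢
    -- Normal direction: integrate along each line `t ↦ (t, z)` first; each line leaves only its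
    -- value at `t = 0`.
    rw [integral_prod_symm _ hint, if_pos rfl, ← integral_neg]
    refine integral_congr_ae (ae_of_all _ fun z => ?_)
    have key : ∀ t : ℝ, lineDeriv ℝ F (consCoord (t, z)) (EuclideanSpace.single 0 1) =
        deriv (F ∘ fun t => consCoord (t, z)) t := fun t => by
      have : (fun s : ℝ => F (consCoord (t, z) + s • EuclideanSpace.single 0 1)) =
          fun s => (F ∘ fun t => consCoord (t, z)) (t + s) := by
        funext s
        simp only [Function.comp]
        congr 1
        exact coord_ext (by simp) fun i => by simp
      rw [lineDeriv, this, deriv_comp_const_add, add_zero]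
    have h0 : (fun t : ℝ => {y : Coord n | 0 < y 0}.indicator
        (fun y => lineDeriv ℝ F y (EuclideanSpace.single 0 1)) (consCoord (t, z))) =
        (Ioi 0).indicator (deriv (F ∘ fun t => consCoord (t, z))) := by
      funext t
      by_cases ht : 0 < t <;> simp [indicator, ht, key]
    simp only [h0]
    rw [integral_indicator measurableSet_Ioi, integral_Ioi_deriv_of_lipschitzWith
      (hcomp _ (hcons z)) (hsupp _ (hcons z))]
    rfl
  | succ j =>
    rw [Measure.volume_eq_prod] at hint ⊢
    -- Tangential direction: on each slice of constant `t` the integrand is a full derivative of a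
    -- compactly supported function.
    rw [integral_prod _ hint, if_neg (Fin.succ_ne_zero j)]
    refine integral_eq_zero_of_ae (ae_of_all _ fun t => ?_)
    have key : ∀ z, lineDeriv ℝ F (consCoord (t, z)) (EuclideanSpace.single j.succ 1) =
        lineDeriv ℝ (F ∘ fun z => consCoord (t, z)) z (EuclideanSpace.single j 1) := fun z => by
      have : (fun s : ℝ => F (consCoord (t, z) + s • EuclideanSpace.single j.succ 1)) =
          fun s => (F ∘ fun z => consCoord (t, z)) (z + s • EuclideanSpace.single j 1) := by
        funext s
        simp only [Function.comp]
        congr 1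
        exact coord_ext (by simp) fun i => by simp
      rw [lineDeriv, this, lineDeriv]
    by_cases ht : 0 < t
    · simp only [indicator, mem_ofPred_eq, consCoord_zero, ht, if_true, key]
      exact integral_lineDeriv_eq_zero volume (hcomp _ (hcons' t)) (hsupp _ (hcons' t)) _
    · simp [indicator, ht]

/-! ### The divergence under a change of coordinates -/

section Det

variable {E : Type*} [NormedAddCommGroup E] [NormedSpace ℝ E] [FiniteDimensional ℝ E]

/-- By the Leibniz expansion in a basis, the determinant is a polynomial in the matrix entries,
which are linear in `A`. -/
lemma differentiable_clm_det : Differentiable ℝ fun A : E →L[ℝ] E => A.det := by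
  classical
  let b := Module.finBasis ℝ E
  have : (fun A : E →L[ℝ] E => A.det) = fun A => ∑ σ : Equiv.Perm _, ((Equiv.Perm.sign σ : ℤ) : ℝ) *
      ∏ i, b.coord (σ i) (A (b i)) := by
    funext A
    rw [ContinuousLinearMap.det, ← LinearMap.det_toMatrix b, Matrix.det_apply]
    simp [LinearMap.toMatrix_apply, Units.smul_def, zsmul_eq_mul]
  rw [this]
  refine Differentiable.fun_sum fun σ _ => Differentiable.const_mul ?_ _
  have h : ∀ i, ∀ A : E →L[ℝ] E, HasFDerivAt (fun A : E →L[ℝ] E => b.coord (σ i) (A (b i)))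
      ((LinearMap.toContinuousLinearMap (b.coord (σ i))).comp
        (ContinuousLinearMap.apply ℝ E (b i))) A := fun i A =>
    ((LinearMap.toContinuousLinearMap (b.coord (σ i))).comp
        (ContinuousLinearMap.apply ℝ E (b i))).hasFDerivAt
  exact fun A => (HasFDerivAt.finsetProd fun i _ => h i A).differentiableAt

/-- Jacobi's formula at an invertible endomorphism. -/
lemma fderiv_clm_det {A A' : E →L[ℝ] E} (h : A ∘L A' = ContinuousLinearMap.id ℝ E)
    (B : E →L[ℝ] E) : fderiv ℝ (fun A : E →L[ℝ] E => A.det) A B =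
      A.det * LinearMap.trace ℝ E (A' ∘L B : E →L[ℝ] E) := by
  classical
  let b := Module.finBasis ℝ E
  have h1 : HasDerivAt (fun s : ℝ => (A + s • B).det)
      (fderiv ℝ (fun A : E →L[ℝ] E => A.det) A B) 0 := by
    have h2 : HasDerivAt (fun s : ℝ => A + s • B) B 0 := by
      simpa using ((hasDerivAt_id (0 : ℝ)).smul_const B).const_add A
    have h3 := (differentiable_clm_det (A + (0 : ℝ) • B)).hasFDerivAt
    have := h3.comp_hasDerivAt (0 : ℝ) h2
    rw [zero_smul, add_zero] at this
    exact this
  -- Factoring out `A` gives $\det(A+sB)=\det A\cdot\det(1+sA'B)$, a polynomial in $s$ whose linear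
  -- coefficient is a trace. Comparing its derivative at 0 with the chain rule in `h1` gives the
  -- formula.
  have h4 : (fun s : ℝ => (A + s • B).det) = fun s => A.det *
      ((1 + (Polynomial.X : Polynomial ℝ) •
        (LinearMap.toMatrix b b (A' ∘L B : E →L[ℝ] E)).map Polynomial.C).det).eval s := by
    funext s
    have : A + s • B = A ∘L (ContinuousLinearMap.id ℝ E + s • (A' ∘L B)) := by
      ext v
      have := DFunLike.congr_fun h (B v)
      simp only [ContinuousLinearMap.coe_comp, Function.comp_apply,
        ContinuousLinearMap.id_apply] at this
      simp [this]
    rw [this, ContinuousLinearMap.det, ContinuousLinearMap.toLinearMap_comp, LinearMap.det_comp]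
    congr 1
    rw [← LinearMap.det_toMatrix b, ← Polynomial.coe_evalRingHom, RingHom.map_det]
    congr 1
    ext i j
    simp [LinearMap.toMatrix_apply, Matrix.one_apply, Finsupp.single_apply, eq_comm]
    split_ifs <;> simp [mul_comm]
  have h5 := (Polynomial.hasDerivAt ((1 + (Polynomial.X : Polynomial ℝ) •
        (LinearMap.toMatrix b b (A' ∘L B : E →L[ℝ] E)).map Polynomial.C).det) 0).const_mul A.det
  rw [← h4] at h5
  rw [h1.unique h5, Matrix.derivative_det_one_add_X_smul, LinearMap.trace_eq_matrix_trace ℝ b]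

/-- The Piola identity. Differentiating $|\det DT|^{-1}DT\,V$ produces two terms with second
derivatives of $T$: one from $DT$ and one from the determinant, by Jacobi's formula. Their traces
cancel because $D^2T$ is symmetric. `S` is a local inverse of `T`, needed to deduce
differentiability of `W` from that of `W ∘ T`. -/
lemma trace_fderiv_of_piola {T S V W : E → E} {y : E} (hT : ContDiffAt ℝ 2 T y)
    {J' : E →L[ℝ] E} (hJ : fderiv ℝ T y ∘L J' = ContinuousLinearMap.id ℝ E)
    (hJ' : J' ∘L fderiv ℝ T y = ContinuousLinearMap.id ℝ E)
    (hV : DifferentiableAt ℝ V y) (hS : DifferentiableAt ℝ S (T y)) (hSy : S (T y) = y)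
    (hTS : ∀ᶠ w in 𝓝 (T y), T (S w) = w)
    (hW : ∀ᶠ x in 𝓝 y, W (T x) = |(fderiv ℝ T x).det|⁻¹ • fderiv ℝ T x (V x)) :
    DifferentiableAt ℝ W (T y) ∧ LinearMap.trace ℝ E (fderiv ℝ W (T y)) =
      |(fderiv ℝ T y).det|⁻¹ * LinearMap.trace ℝ E (fderiv ℝ V y) := by
  set J := fderiv ℝ T with hJdef
  have hdet : (J y).det ≠ 0 := by
    intro h0
    have := congrArg ContinuousLinearMap.det hJ
    rw [ContinuousLinearMap.det, ContinuousLinearMap.toLinearMap_comp, LinearMap.det_comp] at this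
    change (J y).det * _ = _ at this
    rw [h0, zero_mul] at this
    simp [ContinuousLinearMap.det] at this
  have hJd : DifferentiableAt ℝ J y :=
    (hT.fderiv_right (m := 1) (by norm_num)).differentiableAt (by norm_num)
  set D := fderiv ℝ J y with hD
  have hsymm : ∀ v w, D v w = D w v := fun v w =>
    (hT.isSymmSndFDerivAt (by simp)).eq v w
  have hdetd : HasFDerivAt (fun x => (J x).det) ((fderiv ℝ (fun A : E →L[ℝ] E => A.det) (J y)).comp D) y :=
    (differentiable_clm_det (J y)).hasFDerivAt.comp y hJd.hasFDerivAt
  have hδ : ∃ δ' : E →L[ℝ] ℝ, HasFDerivAt (fun x => |(J x).det|⁻¹) δ' y ∧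
      ∀ v, δ' v = - |(J y).det|⁻¹ * LinearMap.trace ℝ E (J' ∘L D v : E →L[ℝ] E) := by
    have h := ((hasDerivAt_abs hdet).inv (abs_ne_zero.2 hdet)).comp_hasFDerivAt y hdetd
    refine ⟨_, h, fun v => ?_⟩
    have hs := sign_mul_self (J y).det
    have ha := abs_ne_zero.2 hdet
    simp only [smul_apply, ContinuousLinearMap.comp_apply,
      fderiv_clm_det hJ, smul_eq_mul]
    rw [div_mul_eq_mul_div, ← mul_assoc, neg_mul, hs]
    field_simp
  obtain ⟨δ', hδ', hδv⟩ := hδ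
  have hU : HasFDerivAt (fun x => |(J x).det|⁻¹ • J x (V x))
      (|(J y).det|⁻¹ • ((J y).comp (fderiv ℝ V y) + D.flip (V y)) + δ'.smulRight (J y (V y))) y :=
    hδ'.smul (hJd.hasFDerivAt.clm_apply hV.hasFDerivAt)
  have hWd : DifferentiableAt ℝ W (T y) := by
    have h1 : DifferentiableAt ℝ ((fun x => |(J x).det|⁻¹ • J x (V x)) ∘ S) (T y) := by
      refine DifferentiableAt.comp _ ?_ hS
      rw [hSy]; exact hU.differentiableAt
    refine h1.congr_of_eventuallyEq ?_
    have hSt : Filter.Tendsto S (𝓝 (T y)) (𝓝 y) := by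
      simpa [hSy] using hS.continuousAt.tendsto
    filter_upwards [hTS, hSt.eventually hW] with w h1 h2
    rw [h1] at h2
    exact h2
  refine ⟨hWd, ?_⟩
  have hTd : HasFDerivAt T (J y) y := (hT.differentiableAt (by norm_num)).hasFDerivAt
  have h2 := (hWd.hasFDerivAt.comp y hTd).congr_of_eventuallyEq
    (Filter.EventuallyEq.symm hW : (fun x => |(J x).det|⁻¹ • J x (V x)) =ᶠ[𝓝 y] W ∘ T)
  have h3 := h2.unique hU
  have h4 : fderiv ℝ W (T y) = (|(J y).det|⁻¹ • ((J y).comp (fderiv ℝ V y) + D.flip (V y)) +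
      δ'.smulRight (J y (V y))) ∘L J' := by
    rw [← h3, ContinuousLinearMap.comp_assoc, hJ, ContinuousLinearMap.comp_id]
  -- The trace is cyclic, so `J'` may be moved to the left, where it cancels `J y`; symmetry of `D`
  -- then replaces `D.flip (V y)` by `D (V y)`, the form in which it cancels against `δ'`.
  have h5 : J' ∘L (|(J y).det|⁻¹ • ((J y).comp (fderiv ℝ V y) + D.flip (V y)) +
      δ'.smulRight (J y (V y))) = |(J y).det|⁻¹ • (fderiv ℝ V y + J' ∘L D (V y)) +
      δ'.smulRight (V y) := by
    have h6 : ∀ v, J' (J y v) = v := fun v => DFunLike.congr_fun hJ' v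
    ext v
    simp [h6, hsymm v]
  rw [h4, ContinuousLinearMap.toLinearMap_comp, LinearMap.trace_comp_comm',
    ← ContinuousLinearMap.toLinearMap_comp, h5]
  have h7 : LinearMap.trace ℝ E (δ'.smulRight (V y) : E →L[ℝ] E) = δ' (V y) := by
    simp
  simp only [ContinuousLinearMap.toLinearMap_add, ContinuousLinearMap.toLinearMap_smul, map_add, map_smul, h7, hδv, smul_eq_mul]
  ring

end Det
/-! ### Gluing measures -/

/-- Inside `U i` every `μ j` is dominated by `μ i`: it agrees with `μ i` on `U i ∩ U j` and has no
mass outside `U j`. Hence the supremum of a compatible family is the measure obtained by gluing. -/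
lemma restrict_iSup_eq_of_restrict_inter_eq {Ω ι : Type*} [MeasurableSpace Ω] {μ : ι → Measure Ω}
    {U : ι → Set Ω} (hU : ∀ i, MeasurableSet (U i)) (h0 : ∀ i, μ i (U i)ᶜ = 0)
    (hμ : ∀ i j, (μ i).restrict (U i ∩ U j) = (μ j).restrict (U i ∩ U j)) (i : ι) :
    (⨆ j, μ j).restrict (U i) = μ i := by
  have hi : (μ i).restrict (U i) = μ i :=
    Measure.restrict_eq_self_of_ae_mem (measure_eq_zero_iff_ae_notMem.1 (h0 i) |>.mono (by simp))
  refine le_antisymm ?_ (hi ▸ Measure.restrict_mono subset_rfl (le_iSup μ i))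
  -- Splitting each `μ j` along `U i` gives a majorant whose second summand disappears on
  -- restriction to `U i`.
  have hle : ⨆ j, μ j ≤ μ i + (⨆ j, μ j).restrict (U i)ᶜ := by
    refine iSup_le fun j => ?_
    conv_lhs => rw [← Measure.restrict_add_restrict_compl (μ := μ j) (hU i)]
    refine add_le_add ?_ (Measure.restrict_mono subset_rfl (le_iSup μ j))
    have hj : (μ j).restrict (U j) = μ j :=
      Measure.restrict_eq_self_of_ae_mem (measure_eq_zero_iff_ae_notMem.1 (h0 j) |>.mono (by simp))
    rw [← hj, Measure.restrict_restrict (hU i), ← hμ]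
    exact Measure.restrict_le_self
  refine (Measure.restrict_mono subset_rfl hle).trans ?_
  rw [Measure.restrict_add, Measure.restrict_restrict (hU i), inter_compl_self,
    Measure.restrict_empty, add_zero]
  exact Measure.restrict_le_self

/-- Charts and their inverses are continuous only on their domains, so preimages are measurable only
after intersection with the domain. -/
lemma measurableSet_inter_preimage {X Y : Type*} [TopologicalSpace X] [MeasurableSpace X]
    [OpensMeasurableSpace X] [TopologicalSpace Y] [MeasurableSpace Y] [BorelSpace Y] {f : X → Y}
    {S : Set X} (hS : MeasurableSet S) (hf : ContinuousOn f S) {B : Set Y} (hB : MeasurableSet B) :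
    MeasurableSet (S ∩ f ⁻¹' B) := by
  have h := hS.subtype_image ((continuousOn_iff_continuous_domRestrict.1 hf).measurable hB)
  convert h using 1
  ext x
  simp [and_comm]

lemma aemeasurable_param {E Ω : Type*} [TopologicalSpace E] [MeasurableSpace E]
    [OpensMeasurableSpace E] [TopologicalSpace Ω] [MeasurableSpace Ω] [BorelSpace Ω]
    {vol : Measure E} {e : E → Ω} {S : Set E}
    (hS : MeasurableSet S) (he : ContinuousOn e S) (ρ : E → ℝ≥0∞) : AEMeasurable e ((vol.restrict S).withDensity ρ) :=
  (he.aemeasurable hS).mono_ac (withDensity_absolutelyContinuous _ _)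

section ParamMeasure

variable {E Ω : Type*} [NormedAddCommGroup E] [NormedSpace ℝ E] [FiniteDimensional ℝ E]
  [MeasurableSpace E] [BorelSpace E] [TopologicalSpace Ω] [MeasurableSpace Ω] [BorelSpace Ω]
  {vol : Measure E} [vol.IsAddHaarMeasure]

lemma map_withDensity_apply {e : E → Ω} {S : Set E} (hS : MeasurableSet S) (he : ContinuousOn e S)
    (ρ : E → ℝ≥0∞) {B : Set Ω} (hB : MeasurableSet B) :
    Measure.map e ((vol.restrict S).withDensity ρ) B = ∫⁻ y in e ⁻¹' B ∩ S, ρ y ∂vol := by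
  rw [Measure.map_apply_of_aemeasurable (aemeasurable_param hS he ρ) hB, withDensity_apply',
    Measure.restrict_restrict' hS]

/-- Two parametrized measures agree on a set contained in the images of both parametrizations,
if the densities transform by the Jacobian determinant of the change of parameters `T`. -/
lemma map_withDensity_restrict_eq {e e' : E → Ω} {S S' : Set E} (hS : MeasurableSet S)
    (hS' : MeasurableSet S') (he : ContinuousOn e S) (he' : ContinuousOn e' S') {ρ ρ' : E → ℝ≥0∞}
    {A : Set Ω} (hA : MeasurableSet A) {T : E → E} {J : E → E →L[ℝ] E}
    (hT : ∀ y ∈ S, e y ∈ A → T y ∈ S' ∧ e' (T y) = e y)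
    (hinj : InjOn e S) (hinj' : InjOn e' S') (hsurj : ∀ y' ∈ S', e' y' ∈ A → e' y' ∈ e '' S)
    (hJ : ∀ y ∈ S, e y ∈ A → HasFDerivWithinAt T (J y) S y)
    (hρ : ∀ y ∈ S, e y ∈ A → ρ y = ENNReal.ofReal |(J y).det| * ρ' (T y)) :
    (Measure.map e ((vol.restrict S).withDensity ρ)).restrict A =
      (Measure.map e' ((vol.restrict S').withDensity ρ')).restrict A := by
  ext B hB
  have hBA := hB.inter hA
  rw [Measure.restrict_apply hB, Measure.restrict_apply hB, map_withDensity_apply hS he ρ hBA,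
    map_withDensity_apply hS' he' ρ' hBA]
  have hmeas : MeasurableSet (e ⁻¹' (B ∩ A) ∩ S) := by
    rw [inter_comm]
    exact measurableSet_inter_preimage hS he hBA
  have himage : e' ⁻¹' (B ∩ A) ∩ S' = T '' (e ⁻¹' (B ∩ A) ∩ S) := by
    ext y'
    constructor
    · rintro ⟨⟨h1, h2⟩, h3⟩
      obtain ⟨y, hy, hyy⟩ := hsurj y' h3 h2
      have h4 := hT y hy (by rw [hyy]; exact h2)
      refine ⟨y, ⟨⟨by rw [hyy]; exact h1, by rw [hyy]; exact h2⟩, hy⟩, ?_⟩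
      exact hinj' h4.1 h3 (h4.2.trans hyy)
    · rintro ⟨y, ⟨⟨h1, h2⟩, h3⟩, rfl⟩
      have h4 := hT y h3 h2
      exact ⟨⟨by rw [h4.2]; exact h1, by rw [h4.2]; exact h2⟩, h4.1⟩
  rw [himage, lintegral_image_eq_lintegral_abs_det_fderiv_mul vol hmeas
    (fun y hy => (hJ y hy.2 hy.1.2).mono inter_subset_right)]
  · exact setLIntegral_congr_fun hmeas fun y hy => hρ y hy.2 hy.1.2
  · intro y hy z hz hyz
    refine hinj hy.2 hz.2 ?_
    rw [← (hT y hy.2 hy.1.2).2, ← (hT z hz.2 hz.1.2).2, hyz]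

end ParamMeasure

/-- A property holds almost everywhere for a parametrized measure if it holds at almost every
parameter. -/
lemma ae_map_withDensity {E Ω : Type*} [TopologicalSpace E] [MeasurableSpace E]
    [BorelSpace E] [TopologicalSpace Ω] [MeasurableSpace Ω] [BorelSpace Ω]
    {vol : Measure E} {e : E → Ω} {S : Set E} (hS : MeasurableSet S) (he : ContinuousOn e S)
    {ρ : E → ℝ≥0∞} {κ : Ω → E} {U : Set Ω} (hU : MeasurableSet U) (hκ : ContinuousOn κ U)
    (heU : MapsTo e S U) (hκS : MapsTo κ U S)
    (hκe : ∀ y ∈ S, κ (e y) = y) (heκ : ∀ x ∈ U, e (κ x) = x) {P : Ω → Prop}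
    (h : ∀ᵐ y ∂vol, y ∈ S → P (e y)) :
    ∀ᵐ x ∂(Measure.map e ((vol.restrict S).withDensity ρ)), P x := by
  -- `P` need not be measurable: the exceptional parameters are enclosed in a measurable null set,
  -- which is carried to `Ω` by the inverse `κ`.
  obtain ⟨N, hN, hNm, hN0⟩ := exists_measurable_superset_of_null h
  have hm : MeasurableSet (U ∩ κ ⁻¹' N) := measurableSet_inter_preimage hU hκ hNm
  have h1 : ∀ᵐ y ∂((vol.restrict S).withDensity ρ), e y ∈ U \ (U ∩ κ ⁻¹' N) := by
    refine (withDensity_absolutelyContinuous _ _).ae_le ?_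
    refine (ae_restrict_iff' hS).2 ?_
    filter_upwards [measure_eq_zero_iff_ae_notMem.1 hN0] with y hy hyS
    exact ⟨heU hyS, fun h => hy (by simpa [hκe y hyS] using h.2)⟩
  have h2 := (ae_map_iff (aemeasurable_param hS he ρ)
    (p := fun x => x ∈ U \ (U ∩ κ ⁻¹' N)) (hU.diff hm)).2 h1
  filter_upwards [h2] with x hx
  have h3 : κ x ∉ N := fun h => hx.2 ⟨hx.1, h⟩
  by_contra h4
  exact h3 (hN fun h5 => h4 (heκ x hx.1 ▸ h5 (hκS hx.1)))

end RiemannianBoundary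

namespace RiemannianBoundary

/-! ### Changes of charts -/

section Charts

variable {n : ℕ} {Ω : Type*} [TopologicalSpace Ω] [ChartedSpace (EuclideanHalfSpace (n + 1)) Ω]

variable (n) in
/-- The extended chart around `p`. -/
abbrev chart (p : Ω) : PartialEquiv Ω (Coord n) := extChartAt (𝓡∂ (n + 1)) p

lemma range_model : range (𝓡∂ (n + 1)) = {y : Coord n | 0 ≤ y 0} :=
  range_modelWithCornersEuclideanHalfSpace (n + 1)

lemma target_subset (p : Ω) : (chart n p).target ⊆ {y : Coord n | 0 ≤ y 0} := by
  rw [← range_model]; exact extChartAt_target_subset_range p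

lemma exists_isOpen_target (p : Ω) : ∃ O : Set (Coord n), IsOpen O ∧
    (chart n p).target = O ∩ {y | 0 ≤ y 0} := by
  refine ⟨(𝓡∂ (n + 1)).symm ⁻¹' (chartAt (EuclideanHalfSpace (n + 1)) p).target,
    (chartAt _ p).open_target.preimage (𝓡∂ (n + 1)).continuous_symm, ?_⟩
  rw [extChartAt_target, range_model]

lemma measurableSet_target (p : Ω) : MeasurableSet (chart n p).target := by
  obtain ⟨O, hO, h⟩ := exists_isOpen_target (n := n) p
  rw [h]
  exact hO.measurableSet.inter (measurableSet_le measurable_const (by fun_prop))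

lemma target_mem_nhds {p : Ω} {y : Coord n} (hy : y ∈ (chart n p).target) (h0 : 0 < y 0) :
    (chart n p).target ∈ 𝓝 y := by
  obtain ⟨O, hO, h⟩ := exists_isOpen_target (n := n) p
  have h1 : {y : Coord n | 0 < y 0} ∈ 𝓝 y :=
    (isOpen_lt continuous_const (by fun_prop)).mem_nhds h0
  rw [h] at hy ⊢
  filter_upwards [hO.mem_nhds hy.1, h1] with z hz hz' using ⟨hz, hz'.le⟩

lemma target_mem_nhdsWithin {p : Ω} {y : Coord n} (hy : y ∈ (chart n p).target) :
    (chart n p).target ∈ 𝓝[range (𝓡∂ (n + 1))] y :=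
  extChartAt_target_mem_nhdsWithin_of_mem hy

lemma range_mem_nhds {y : Coord n} (h0 : 0 < y 0) : range (𝓡∂ (n + 1)) ∈ 𝓝 y := by
  have h1 : {y : Coord n | 0 < y 0} ∈ 𝓝 y :=
    (isOpen_lt continuous_const (by fun_prop)).mem_nhds h0
  rw [range_model]
  filter_upwards [h1] with z hz using le_of_lt hz

lemma convex_range_model : Convex ℝ (range (𝓡∂ (n + 1))) := (𝓡∂ (n + 1)).convex_range

lemma range_mem {p : Ω} {y : Coord n} (hy : y ∈ (chart n p).target) :
    y ∈ range (𝓡∂ (n + 1)) := extChartAt_target_subset_range p hy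

variable (n) in
/-- The change of coordinates from the chart around `p` to the chart around `q`. -/
def trans (p q : Ω) (y : Coord n) : Coord n := chart n q ((chart n p).symm y)

variable (n) in
/-- The domain of the change of coordinates. -/
def overlap (p q : Ω) : Set (Coord n) :=
  (chart n p).target ∩ (chart n p).symm ⁻¹' (chart n q).source

lemma overlap_mem_nhdsWithin {p q : Ω} {y : Coord n} (hy : y ∈ overlap n p q) :
    overlap n p q ∈ 𝓝[range (𝓡∂ (n + 1))] y := by
  refine Filter.inter_mem (target_mem_nhdsWithin hy.1) ?_
  have h := (continuousOn_extChartAt_symm (I := 𝓡∂ (n + 1)) p y hy.1)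
    ((isOpen_extChartAt_source (I := 𝓡∂ (n + 1)) q).mem_nhds hy.2)
  rwa [Filter.mem_map, nhdsWithin_extChartAt_target_eq_of_mem hy.1] at h

lemma symm_trans {p q : Ω} {y : Coord n} (hy : y ∈ overlap n p q) :
    (chart n q).symm (trans n p q y) = (chart n p).symm y :=
  (chart n q).left_inv hy.2

lemma trans_mem {p q : Ω} {y : Coord n} (hy : y ∈ overlap n p q) :
    trans n p q y ∈ overlap n q p :=
  ⟨(chart n q).map_source hy.2, by
    change (chart n q).symm (trans n p q y) ∈ (chart n p).source
    rw [symm_trans hy]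
    exact (chart n p).map_target hy.1⟩

lemma trans_trans {p q : Ω} {y : Coord n} (hy : y ∈ overlap n p q) :
    trans n q p (trans n p q y) = y := by
  rw [trans, symm_trans hy, (chart n p).right_inv hy.1]

variable [IsManifold (𝓡∂ (n + 1)) ∞ Ω]

instance isManifold_one : IsManifold (𝓡∂ (n + 1)) 1 Ω :=
  IsManifold.of_le (n := ∞) (by norm_cast)

/-- Boundary points are defined by the preferred chart at the point, but for a $C^1$ structure
interior points are recognised in every chart of the atlas; in the half space the interior is where
the first coordinate is positive. -/
lemma isBoundaryPoint_symm_iff {p : Ω} {y : Coord n} (hy : y ∈ (chart n p).target) :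
    (𝓡∂ (n + 1)).IsBoundaryPoint ((chart n p).symm y) ↔ y 0 = 0 := by
  have hs := (chart n p).map_target hy
  rw [extChartAt_source] at hs
  rw [(𝓡∂ (n + 1)).isBoundaryPoint_iff_not_isInteriorPoint,
    (𝓡∂ (n + 1)).isInteriorPoint_iff_of_mem_atlas (n := 1) one_ne_zero
      (chart_mem_atlas (EuclideanHalfSpace (n + 1)) p) hs]
  change chart n p ((chart n p).symm y) ∉ interior (chart n p).target ↔ _
  rw [(chart n p).right_inv hy]
  constructor
  · intro h
    by_contra h0
    exact h (mem_interior_iff_mem_nhds.2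
      (target_mem_nhds hy (lt_of_le_of_ne (target_subset p hy) (Ne.symm h0))))
  · intro h0 h
    have h1 : y ∈ interior (range (𝓡∂ (n + 1))) :=
      interior_mono (extChartAt_target_subset_range p) h
    rw [interior_range_modelWithCornersEuclideanHalfSpace] at h1
    exact (lt_irrefl (0 : ℝ)) (h0 ▸ h1)

variable (n) in
/-- The derivative of the chart around `p`, at the point `x`. -/
def dChart (p x : Ω) : Coord n →L[ℝ] Coord n :=
  mfderiv (𝓡∂ (n + 1)) 𝓘(ℝ, Coord n) (chart n p) x

variable (n) in
/-- The derivative of the inverse of the chart around `p`, at the coordinates `y`. -/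
def dParam (p : Ω) (y : Coord n) : Coord n →L[ℝ] Coord n :=
  mfderivWithin 𝓘(ℝ, Coord n) (𝓡∂ (n + 1)) (chart n p).symm (range (𝓡∂ (n + 1))) y

lemma dChart_comp_dParam {p : Ω} {y : Coord n} (hy : y ∈ (chart n p).target) :
    dChart n p ((chart n p).symm y) ∘L dParam n p y = ContinuousLinearMap.id ℝ (Coord n) :=
  mfderiv_extChartAt_comp_mfderivWithin_extChartAt_symm hy

lemma dParam_comp_dChart {p : Ω} {y : Coord n} (hy : y ∈ (chart n p).target) :
    dParam n p y ∘L dChart n p ((chart n p).symm y) = ContinuousLinearMap.id ℝ (Coord n) :=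
  mfderivWithin_extChartAt_symm_comp_mfderiv_extChartAt hy

lemma dChart_dParam {p : Ω} {y : Coord n} (hy : y ∈ (chart n p).target) (v : Coord n) :
    dChart n p ((chart n p).symm y) (dParam n p y v) = v :=
  DFunLike.congr_fun (dChart_comp_dParam hy) v

lemma dParam_dChart {p : Ω} {y : Coord n} (hy : y ∈ (chart n p).target) (v : Coord n) :
    dParam n p y (dChart n p ((chart n p).symm y) v) = v :=
  DFunLike.congr_fun (dParam_comp_dChart hy) v

/-- Tangent vectors at `x` are by convention written in the preferred chart at `x`. This is what
relates `firstCoord` to the coordinates of another chart. -/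
lemma dChart_self (x : Ω) : dChart n x x = ContinuousLinearMap.id ℝ (Coord n) := by
  have hx := mem_chart_source (EuclideanHalfSpace (n + 1)) x
  have h1 : dChart n x x = mfderiv (𝓡∂ (n + 1)) (𝓡∂ (n + 1)) (chartAt _ x) x :=
    (hasMFDerivAt_extChartAt hx).mfderiv
  rw [h1, mfderiv_chartAt_eq_tangentCoordChange hx]
  ext1 v
  exact tangentCoordChange_self (by rwa [extChartAt_source])

variable (n) in
/-- The derivative of the change of coordinates. -/
def dTrans (p q : Ω) (y : Coord n) : Coord n →L[ℝ] Coord n :=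
  dChart n q ((chart n p).symm y) ∘L dParam n p y

lemma hasFDerivWithinAt_trans {p q : Ω} {y : Coord n} (hy : y ∈ overlap n p q) :
    HasFDerivWithinAt (trans n p q) (dTrans n p q y) (range (𝓡∂ (n + 1))) y := by
  have h1 : HasMFDerivWithinAt 𝓘(ℝ, Coord n) (𝓡∂ (n + 1)) (chart n p).symm
      (range (𝓡∂ (n + 1))) y (dParam n p y) :=
    (mdifferentiableWithinAt_extChartAt_symm hy.1).hasMFDerivWithinAt
  have h2 : HasMFDerivAt (𝓡∂ (n + 1)) 𝓘(ℝ, Coord n) (chart n q) ((chart n p).symm y)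
      (dChart n q ((chart n p).symm y)) :=
    (mdifferentiableAt_extChartAt (by simpa using hy.2)).hasMFDerivAt
  exact (h2.comp_hasMFDerivWithinAt y h1).hasFDerivWithinAt

lemma contDiffWithinAt_trans {p q : Ω} {y : Coord n} (hy : y ∈ overlap n p q) :
    ContDiffWithinAt ℝ ∞ (trans n p q) (range (𝓡∂ (n + 1))) y := by
  refine contDiffWithinAt_ext_coord_change (I := 𝓡∂ (n + 1)) q p ?_
  rw [PartialEquiv.trans_source]
  exact hy

lemma dTrans_comp_dTrans {p q : Ω} {y : Coord n} (hy : y ∈ overlap n p q) :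
    dTrans n q p (trans n p q y) ∘L dTrans n p q y = ContinuousLinearMap.id ℝ (Coord n) := by
  ext1 v
  have h := dParam_dChart (trans_mem hy).1 (dParam n p y v)
  simp only [dTrans, symm_trans hy, ContinuousLinearMap.comp_apply] at h ⊢
  rw [h, dChart_dParam hy.1]
  rfl

lemma dParam_eq {p q : Ω} {y : Coord n} (hy : y ∈ overlap n p q) (v : Coord n) :
    dParam n p y v = dParam n q (trans n p q y) (dTrans n p q y v) := by
  have h := dParam_dChart (trans_mem hy).1 (dParam n p y v)
  rw [symm_trans hy] at h
  exact h.symm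

lemma dParam_chartField (X : ∀ x : Ω, TangentSpace (𝓡∂ (n + 1)) x) {p : Ω} {y : Coord n}
    (hy : y ∈ (chart n p).target) : dParam n p y (chartField X p y) = X ((chart n p).symm y) :=
  dParam_dChart hy _

lemma chartField_trans (X : ∀ x : Ω, TangentSpace (𝓡∂ (n + 1)) x) {p q : Ω} {y : Coord n}
    (hy : y ∈ overlap n p q) :
    chartField X q (trans n p q y) = dTrans n p q y (chartField X p y) := by
  change dChart n q ((chart n q).symm (trans n p q y)) (X ((chart n q).symm (trans n p q y))) = _
  rw [symm_trans hy, dTrans, ContinuousLinearMap.comp_apply,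
    dParam_chartField X hy.1]

/-- Both sides say that the same point of `Ω` lies on the boundary. -/
lemma trans_zero_eq_zero_iff {p q : Ω} {y : Coord n} (hy : y ∈ overlap n p q) :
    trans n p q y 0 = 0 ↔ y 0 = 0 := by
  rw [← isBoundaryPoint_symm_iff (trans_mem hy).1, symm_trans hy, isBoundaryPoint_symm_iff hy.1]

lemma trans_zero_pos {p q : Ω} {y : Coord n} (hy : y ∈ overlap n p q) (h0 : 0 < y 0) :
    0 < trans n p q y 0 :=
  lt_of_le_of_ne (target_subset q (trans_mem hy).1)
    (fun h => h0.ne' ((trans_zero_eq_zero_iff hy).1 h.symm))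

/-! The first row of the derivative of a change of coordinates at a boundary point. -/

/-- At a boundary point the first coordinate of the change of charts attains its minimum 0 over the
half space, so its derivative is nonnegative in every direction that does not leave the half space.
-/
lemma dTrans_apply_zero {p q : Ω} {y : Coord n} (hy : y ∈ overlap n p q) (h0 : y 0 = 0)
    {v : Coord n} (hv : 0 ≤ v 0) : 0 ≤ dTrans n p q y v 0 := by
  have h1 : HasFDerivWithinAt (fun y => trans n p q y 0)
      ((EuclideanSpace.proj 0 : Coord n →L[ℝ] ℝ) ∘L dTrans n p q y) (range (𝓡∂ (n + 1))) y :=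
    (EuclideanSpace.proj (0 : Fin (n + 1)) : Coord n →L[ℝ] ℝ).hasFDerivAt.comp_hasFDerivWithinAt y
      (hasFDerivWithinAt_trans hy)
  have h2 : IsLocalMinOn (fun y => trans n p q y 0) (range (𝓡∂ (n + 1))) y := by
    filter_upwards [overlap_mem_nhdsWithin hy] with z hz
    rw [(trans_zero_eq_zero_iff hy).2 h0]
    exact target_subset q (trans_mem hz).1
  refine h2.hasFDerivWithinAt_nonneg h1 (mem_posTangentConeAt_of_segment_subset ?_)
  refine convex_range_model.segment_subset (range_mem hy.1) ?_
  rw [range_model]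
  simpa [h0] using hv

lemma dTrans_apply_tangent {p q : Ω} {y : Coord n} (hy : y ∈ overlap n p q) (h0 : y 0 = 0)
    {v : Coord n} (hv : v 0 = 0) : dTrans n p q y v 0 = 0 := by
  have h1 := dTrans_apply_zero hy h0 hv.ge
  have h2 := dTrans_apply_zero hy h0 (v := -v) (by simp [hv])
  simp only [map_neg, PiLp.neg_apply] at h2
  linarith

/-- Tangential directions are preserved, so the first row of the Jacobian is $(c,0,\dots,0)$ with
$c\ge0$. Invertibility excludes $c=0$. The factor $c$ will cancel when the normal is normalised, so
any chart gives the same outward normal. -/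
lemma exists_dTrans_apply_zero_eq {p q : Ω} {y : Coord n} (hy : y ∈ overlap n p q) (h0 : y 0 = 0) :
    ∃ c : ℝ, 0 < c ∧ ∀ v, dTrans n p q y v 0 = c * v 0 := by
  set e : Coord n := EuclideanSpace.single 0 1
  have h1 : ∀ v, dTrans n p q y v 0 = dTrans n p q y e 0 * v 0 := fun v => by
    have : v = v 0 • e + (v - v 0 • e) := by abel
    conv_lhs => rw [this, map_add, map_smul]
    rw [PiLp.add_apply, dTrans_apply_tangent hy h0 (v := v - v 0 • e) (by simp [e])]
    simp [mul_comm]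
  refine ⟨dTrans n p q y e 0, lt_of_le_of_ne (dTrans_apply_zero hy h0 (by simp [e])) ?_, h1⟩
  intro h
  have hy' := trans_mem hy
  have h2 := DFunLike.congr_fun (dTrans_comp_dTrans hy') e
  rw [trans_trans hy] at h2
  have h3 := congrArg (fun v : Coord n => v 0) h2
  have h4 : e 0 = 1 := by simp [e]
  simp only [ContinuousLinearMap.comp_apply, ContinuousLinearMap.id_apply, h4] at h3
  have h6 := h1 (dTrans n q p (trans n p q y) e)
  rw [h3, ← h, zero_mul] at h6
  exact one_ne_zero h6

end Charts

end RiemannianBoundary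

namespace RiemannianBoundary

section Gram

variable {n : ℕ} {Ω : Type*} [TopologicalSpace Ω] [ChartedSpace (EuclideanHalfSpace (n + 1)) Ω]
  [IsManifold (𝓡∂ (n + 1)) ∞ Ω] (g : Metric n Ω)

/-! ### The Gram matrix -/

/-- The metric at `x` as a bilinear form on `ℝ^(n+1)`. -/
def metricAt (x : Ω) : Coord n →L[ℝ] Coord n →L[ℝ] ℝ := g.inner x

lemma metricAt_pos (x : Ω) {v : Coord n} (hv : v ≠ 0) : 0 < metricAt g x v v := g.pos x v hv

lemma metricAt_symm (x : Ω) (v w : Coord n) : metricAt g x v w = metricAt g x w v := g.symm x v w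

lemma gram_apply (p : Ω) (y : Coord n) (i j : Fin (n + 1)) :
    gram g p y i j = metricAt g ((chart n p).symm y) (dParam n p y (EuclideanSpace.single i 1))
      (dParam n p y (EuclideanSpace.single j 1)) := rfl

lemma coord_eq_sum (v : Coord n) : v = ∑ i, v i • (EuclideanSpace.single i (1 : ℝ) : Coord n) := by
  ext j
  simp [Finset.sum_apply, Pi.single_apply]

lemma metricAt_dParam (p : Ω) (y v w : Coord n) :
    metricAt g ((chart n p).symm y) (dParam n p y v) (dParam n p y w) =
      (v : Fin (n + 1) → ℝ) ⬝ᵥ (gram g p y).mulVec w := by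
  conv_lhs => rw [coord_eq_sum v, coord_eq_sum w]
  simp only [map_sum, map_smul, sum_apply, smul_apply, smul_eq_mul,
    dotProduct, Matrix.mulVec, gram_apply, Finset.mul_sum]
  rw [Finset.sum_comm]
  refine Finset.sum_congr rfl fun i _ => Finset.sum_congr rfl fun j _ => by ring

/-- The matrix of an endomorphism of `ℝ^(n+1)` in the standard basis. -/
def mat (A : Coord n →L[ℝ] Coord n) : Matrix (Fin (n + 1)) (Fin (n + 1)) ℝ :=
  Matrix.of fun i j => A (EuclideanSpace.single j 1) i

lemma det_mat (A : Coord n →L[ℝ] Coord n) : (mat A).det = A.det := by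
  rw [ContinuousLinearMap.det, ← LinearMap.det_toMatrix (EuclideanSpace.basisFun _ ℝ).toBasis]
  congr 1

/-- Both Gram matrices represent one inner product, in coordinate bases related by the Jacobian,
hence are congruent. -/
lemma gram_eq_trans {p q : Ω} {y : Coord n} (hy : y ∈ overlap n p q) :
    gram g p y = (mat (dTrans n p q y)).transpose * gram g q (trans n p q y) *
      mat (dTrans n p q y) := by
  ext i j
  rw [gram_apply, dParam_eq hy, dParam_eq hy, ← symm_trans hy, metricAt_dParam]
  simp [Matrix.mul_apply, dotProduct, Matrix.mulVec, mat, Finset.sum_mul, Finset.mul_sum]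
  rw [Finset.sum_comm]
  refine Finset.sum_congr rfl fun i _ => Finset.sum_congr rfl fun j _ => by ring

lemma posDef_gram {p : Ω} {y : Coord n} (hy : y ∈ (chart n p).target) : (gram g p y).PosDef := by
  refine Matrix.PosDef.of_dotProduct_mulVec_pos ?_ ?_
  · ext i j
    simp [gram_apply, metricAt_symm g _ (dParam n p y (EuclideanSpace.single i 1))]
  · intro v hv
    have h := metricAt_dParam g p y (WithLp.toLp 2 v) (WithLp.toLp 2 v)
    simp only [star_trivial]
    refine h ▸ metricAt_pos g _ fun h0 => hv ?_
    have h1 := dChart_dParam hy (WithLp.toLp 2 v)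
    rw [h0, map_zero] at h1
    exact (congrArg WithLp.ofLp h1).symm

lemma density_pos {p : Ω} {y : Coord n} (hy : y ∈ (chart n p).target) : 0 < density g p y :=
  Real.sqrt_pos.2 (posDef_gram g hy).det_pos

lemma posDef_gram_submatrix {p : Ω} {y : Coord n} (hy : y ∈ (chart n p).target) :
    ((gram g p y).submatrix Fin.succ Fin.succ).PosDef :=
  (posDef_gram g hy).submatrix (Fin.succ_injective n)

lemma boundaryDensity_pos {p : Ω} {z : EuclideanSpace ℝ (Fin n)}
    (hz : face z ∈ (chart n p).target) : 0 < boundaryDensity g p z :=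
  Real.sqrt_pos.2 (posDef_gram_submatrix g hz).det_pos

lemma density_eq_trans {p q : Ω} {y : Coord n} (hy : y ∈ overlap n p q) :
    density g p y = |(dTrans n p q y).det| * density g q (trans n p q y) := by
  rw [density, density, gram_eq_trans g hy, Matrix.det_mul, Matrix.det_mul, Matrix.det_transpose,
    det_mat, ← Real.sqrt_sq_eq_abs, ← Real.sqrt_mul (sq_nonneg _)]
  congr 1
  ring

/-- The coordinate fields are images of constant fields under the tangent map of the inverse chart,
hence smooth along it; the metric, a smooth section of bilinear forms, is evaluated on two of them.
-/
lemma contDiffOn_gram (p : Ω) (i j : Fin (n + 1)) :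
    ContDiffOn ℝ ∞ (fun y => gram g p y i j) (chart n p).target := by
  have hsec : ∀ k : Fin (n + 1), ContMDiffOn 𝓘(ℝ, Coord n) (𝓡∂ (n + 1)).tangent ∞
      (fun y => (⟨(chart n p).symm y, coordVector p y k⟩ : TangentBundle (𝓡∂ (n + 1)) Ω))
      (chart n p).target := by
    intro k
    have h1 : ContMDiffOn 𝓘(ℝ, Coord n).tangent (𝓡∂ (n + 1)).tangent ∞
        (tangentMapWithin 𝓘(ℝ, Coord n) (𝓡∂ (n + 1)) (chart n p).symm (chart n p).target)
        (Bundle.TotalSpace.proj ⁻¹' (chart n p).target) :=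
      (contMDiffOn_extChartAt_symm (n := ∞) p).contMDiffOn_tangentMapWithin (by norm_cast)
        (uniqueDiffOn_extChartAt_target p).uniqueMDiffOn
    have h2 : ContMDiffOn 𝓘(ℝ, Coord n) 𝓘(ℝ, Coord n).tangent ∞
        (fun y => (⟨y, EuclideanSpace.single k 1⟩ : TangentBundle 𝓘(ℝ, Coord n) (Coord n)))
        (chart n p).target := by
      refine contMDiffOn_vectorSpace_iff_contDiffOn.2 contDiffOn_const
    refine (h1.comp h2 fun y hy => hy).congr fun y hy => ?_
    -- The derivative within the whole half space and the derivative within the chart target agree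
    -- by unique differentiability.
    have h3 := mfderivWithin_subset (extChartAt_target_subset_range p)
      ((uniqueDiffOn_extChartAt_target (I := 𝓡∂ (n + 1)) p).uniqueMDiffOn y hy)
      (mdifferentiableWithinAt_extChartAt_symm (I := 𝓡∂ (n + 1)) hy)
    simp only [coordVector, Function.comp_def, tangentMapWithin, h3]
  intro y hy
  have h1 : ContMDiffWithinAt 𝓘(ℝ, Coord n) ((𝓡∂ (n + 1)).prod 𝓘(ℝ)) ∞
      (fun m => Bundle.TotalSpace.mk' ℝ (E := Bundle.Trivial Ω ℝ) ((chart n p).symm m)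
        (g.inner ((chart n p).symm m) (coordVector p m i) (coordVector p m j)))
      (chart n p).target y := by
    apply ContMDiffWithinAt.clm_bundle_apply₂ (F₁ := Coord n) (F₂ := Coord n)
    · exact g.contMDiff.contMDiffAt.comp_contMDiffWithinAt y (contMDiffOn_extChartAt_symm p y hy)
    · exact hsec i y hy
    · exact hsec j y hy
  simp only [Bundle.contMDiffWithinAt_totalSpace] at h1
  exact h1.2.contDiffWithinAt

lemma contDiffOn_density (p : Ω) : ContDiffOn ℝ ∞ (density g p) (chart n p).target := by
  have h : ContDiffOn ℝ ∞ (fun y => (gram g p y).det) (chart n p).target := by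
    simp only [Matrix.det_apply]
    refine ContDiffOn.sum fun σ _ => ContDiffOn.const_smul _ ?_
    exact contDiffOn_prod fun i _ => contDiffOn_gram g p _ _
  exact h.sqrt fun y hy => (posDef_gram g hy).det_pos.ne'

end Gram

end RiemannianBoundary

namespace RiemannianBoundary

/-! ### Riemannian volume of the manifold and of its boundary: gluing, finiteness, positivity -/

section Volume

variable {n : ℕ}

variable (n) in
/-- The inclusion `z ↦ (0, z)` as a linear map. -/
def faceL : EuclideanSpace ℝ (Fin n) →L[ℝ] Coord n :=
  LinearMap.toContinuousLinearMap
    { toFun := face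
      map_add' := fun x y => coord_ext (by simp) fun i => by simp
      map_smul' := fun c x => coord_ext (by simp) fun i => by simp }

@[simp] lemma faceL_apply (z : EuclideanSpace ℝ (Fin n)) : faceL n z = face z := rfl

variable (n) in
/-- The projection `(t, z) ↦ z` as a linear map. -/
def tailL : Coord n →L[ℝ] EuclideanSpace ℝ (Fin n) :=
  LinearMap.toContinuousLinearMap
    { toFun := fun v => WithLp.toLp 2 fun i => v i.succ
      map_add' := fun x y => by ext; simp
      map_smul' := fun c x => by ext; simp }

@[simp] lemma tailL_apply (v : Coord n) (i : Fin n) : tailL n v i = v i.succ := rfl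

@[simp] lemma tailL_face (z : EuclideanSpace ℝ (Fin n)) : tailL n (face z) = z := by
  ext i; simp

lemma face_tailL {v : Coord n} (hv : v 0 = 0) : face (tailL n v) = v :=
  coord_ext (by simp [hv]) fun i => by simp

lemma continuous_face : Continuous (face : EuclideanSpace ℝ (Fin n) → Coord n) :=
  (faceL n).continuous

lemma exists_isOpen_setLIntegral_lt_top {E : Type*} [NormedAddCommGroup E] [NormedSpace ℝ E]
    [FiniteDimensional ℝ E] [MeasurableSpace E] [BorelSpace E] (μ : Measure E) [μ.IsAddHaarMeasure]
    {S : Set E} (hS : MeasurableSet S) {ρ : E → ℝ} (hρ : ContinuousOn ρ S) {y : E} (hy : y ∈ S) :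
    ∃ V, IsOpen V ∧ y ∈ V ∧ ∫⁻ y in V ∩ S, ENNReal.ofReal (ρ y) ∂μ < ⊤ := by
  have h1 : ∀ᶠ z in 𝓝[S] y, ρ z < ρ y + 1 := (hρ y hy).eventually_lt_const (by linarith)
  obtain ⟨V, hV, hyV, h2⟩ := mem_nhdsWithin.1 h1
  refine ⟨V ∩ Metric.ball y 1, hV.inter Metric.isOpen_ball, ⟨hyV, Metric.mem_ball_self one_pos⟩, ?_⟩
  calc ∫⁻ y in V ∩ Metric.ball y 1 ∩ S, ENNReal.ofReal (ρ y) ∂μ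
      ≤ ∫⁻ _ in V ∩ Metric.ball y 1 ∩ S, ENNReal.ofReal (ρ y + 1) ∂μ :=
        setLIntegral_mono' ((hV.measurableSet.inter Metric.isOpen_ball.measurableSet).inter hS)
          fun z hz => ENNReal.ofReal_le_ofReal (h2 ⟨hz.1.1, hz.2⟩).le
    _ < ⊤ := by
        rw [setLIntegral_const]
        refine ENNReal.mul_lt_top ENNReal.ofReal_lt_top ((measure_mono ?_).trans_lt
          (measure_ball_lt_top (μ := μ) (x := y) (r := 1)))
        exact fun z hz => hz.1.2

lemma setLIntegral_ofReal_ne_zero {E : Type*} [TopologicalSpace E] [MeasurableSpace E]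
    [BorelSpace E] {μ : Measure E} {S : Set E} (hS : MeasurableSet S) {ρ : E → ℝ}
    (hρ : ContinuousOn ρ S) (hpos : ∀ y ∈ S, 0 < ρ y) (h0 : μ S ≠ 0) :
    ∫⁻ y in S, ENNReal.ofReal (ρ y) ∂μ ≠ 0 := by
  intro h
  rw [lintegral_eq_zero_iff' (hρ.aemeasurable hS).ennreal_ofReal] at h
  have h1 := (ae_restrict_iff' hS).1 h
  refine h0 (measure_eq_zero_iff_ae_notMem.2 ?_)
  filter_upwards [h1] with y hy hyS
  have := hy hyS
  simp only [Pi.zero_apply, ENNReal.ofReal_eq_zero] at this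
  exact (hpos y hyS).not_ge this

variable {Ω : Type*} [TopologicalSpace Ω] [ChartedSpace (EuclideanHalfSpace (n + 1)) Ω]

lemma continuousOn_symm_face (p : Ω) :
    ContinuousOn (fun z => (chart n p).symm (face z)) (face ⁻¹' (chart n p).target) :=
  (continuousOn_extChartAt_symm p).comp continuous_face.continuousOn fun _ hz => hz

lemma measurableSet_faceTarget (p : Ω) :
    MeasurableSet (face ⁻¹' (chart n p).target : Set (EuclideanSpace ℝ (Fin n))) :=
  continuous_face.measurable (measurableSet_target p)

lemma isOpen_faceTarget (p : Ω) :
    IsOpen (face ⁻¹' (chart n p).target : Set (EuclideanSpace ℝ (Fin n))) := by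
  obtain ⟨O, hO, h⟩ := exists_isOpen_target (n := n) p
  have : (face ⁻¹' (chart n p).target : Set (EuclideanSpace ℝ (Fin n))) = face ⁻¹' O := by
    ext z
    rw [mem_preimage, h]
    simp
  rw [this]
  exact hO.preimage continuous_face

lemma injOn_symm (p : Ω) : InjOn (chart n p).symm (chart n p).target := (chart n p).symm.injOn

lemma injOn_symm_face (p : Ω) :
    InjOn (fun z => (chart n p).symm (face z)) (face ⁻¹' (chart n p).target) := by
  intro z hz w hw h
  have := injOn_symm p hz hw h
  rw [← tailL_face z, this, tailL_face]

lemma measurableSet_source [MeasurableSpace Ω] [BorelSpace Ω] (p : Ω) :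
    MeasurableSet (chart n p).source :=
  (isOpen_extChartAt_source p).measurableSet

variable (n) in
/-- The change of boundary coordinates. -/
def transFace (p q : Ω) (z : EuclideanSpace ℝ (Fin n)) : EuclideanSpace ℝ (Fin n) :=
  tailL n (trans n p q (face z))

variable [IsManifold (𝓡∂ (n + 1)) ∞ Ω]

lemma face_transFace {p q : Ω} {z : EuclideanSpace ℝ (Fin n)} (hz : face z ∈ overlap n p q) :
    face (transFace n p q z) = trans n p q (face z) :=
  face_tailL ((trans_zero_eq_zero_iff hz).2 (face_zero z))

variable (n) in
/-- The derivative of the change of boundary coordinates. -/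
def dTransFace (p q : Ω) (z : EuclideanSpace ℝ (Fin n)) :
    EuclideanSpace ℝ (Fin n) →L[ℝ] EuclideanSpace ℝ (Fin n) :=
  tailL n ∘L dTrans n p q (face z) ∘L faceL n

lemma hasFDerivAt_transFace {p q : Ω} {z : EuclideanSpace ℝ (Fin n)}
    (hz : face z ∈ overlap n p q) :
    HasFDerivAt (transFace n p q) (dTransFace n p q z) z := by
  have h1 : HasFDerivAt (trans n p q ∘ faceL n) (dTrans n p q (face z) ∘L faceL n) z :=
    (hasFDerivWithinAt_trans hz).comp_hasFDerivAt_of_eq z (faceL n).hasFDerivAt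
      (Filter.Eventually.of_forall fun w => by rw [range_model]; simp) rfl
  exact (tailL n).hasFDerivAt.comp z h1

variable (g : Metric n Ω)

/-- The first row of the Jacobian $A$ vanishes off the diagonal at a boundary point, so the lower
right block of $A^{T}GA$ involves only the lower right blocks of $A$ and $G$. That block of $A$ is
the Jacobian of the change of boundary coordinates. -/
lemma boundaryDensity_eq_trans {p q : Ω} {z : EuclideanSpace ℝ (Fin n)}
    (hz : face z ∈ overlap n p q) :
    boundaryDensity g p z =
      |(dTransFace n p q z).det| * boundaryDensity g q (transFace n p q z) := by
  have h1 : (gram g p (face z)).submatrix Fin.succ Fin.succ =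
      ((mat (dTrans n p q (face z))).submatrix Fin.succ Fin.succ).transpose *
        (gram g q (trans n p q (face z))).submatrix Fin.succ Fin.succ *
        (mat (dTrans n p q (face z))).submatrix Fin.succ Fin.succ := by
    have h0 : ∀ j : Fin n, mat (dTrans n p q (face z)) 0 j.succ = 0 := fun j =>
      dTrans_apply_tangent hz (face_zero z) (by simp)
    ext i j
    rw [gram_eq_trans g hz]
    simp [Matrix.mul_apply, Fin.sum_univ_succ, h0]
  have h2 : ((mat (dTrans n p q (face z))).submatrix Fin.succ Fin.succ).det =
      (dTransFace n p q z).det := by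
    rw [ContinuousLinearMap.det, ← LinearMap.det_toMatrix (EuclideanSpace.basisFun _ ℝ).toBasis]
    congr 1
    ext i j
    have h3 : face (EuclideanSpace.single j (1 : ℝ)) = EuclideanSpace.single j.succ 1 :=
      coord_ext (by simp) fun i => by simp
    simp [mat, LinearMap.toMatrix_apply, dTransFace, h3]
  rw [boundaryDensity, boundaryDensity, h1, Matrix.det_mul, Matrix.det_mul, Matrix.det_transpose,
    h2, face_transFace hz, ← Real.sqrt_sq_eq_abs, ← Real.sqrt_mul (sq_nonneg _)]
  congr 1
  ring

lemma continuousOn_boundaryDensity (p : Ω) :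
    ContinuousOn (boundaryDensity g p) (face ⁻¹' (chart n p).target) := by
  have h : ContinuousOn (fun z : EuclideanSpace ℝ (Fin n) =>
      ((gram g p (face z)).submatrix Fin.succ Fin.succ).det) (face ⁻¹' (chart n p).target) := by
    simp only [Matrix.det_apply]
    refine continuousOn_finsetSum _ fun σ _ => ContinuousOn.const_smul ?_ _
    refine continuousOn_finsetProd _ fun i _ => ?_
    exact (contDiffOn_gram g p _ _).continuousOn.comp continuous_face.continuousOn fun _ hz => hz
  exact h.sqrt

variable [MeasurableSpace Ω] [BorelSpace Ω]

lemma chartVolume_compl_source (p : Ω) : chartVolume g p (chart n p).sourceᶜ = 0 := by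
  rw [chartVolume, map_withDensity_apply (measurableSet_target p)
    (continuousOn_extChartAt_symm p) _ (measurableSet_source p).compl]
  have : (chart n p).symm ⁻¹' (chart n p).sourceᶜ ∩ (chart n p).target = ∅ := by
    ext y
    simp only [mem_inter_iff, mem_preimage, mem_compl_iff, mem_empty_iff_false, iff_false, not_and]
    exact fun h1 h2 => h1 ((chart n p).map_target h2)
  rw [this]
  simp

lemma chartBoundaryVolume_compl_source (p : Ω) :
    chartBoundaryVolume g p (chart n p).sourceᶜ = 0 := by
  rw [chartBoundaryVolume, map_withDensity_apply (measurableSet_faceTarget p)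
    (continuousOn_symm_face p) _ (measurableSet_source p).compl]
  have : (fun z => (chart n p).symm (face z)) ⁻¹' (chart n p).sourceᶜ ∩
      face ⁻¹' (chart n p).target = ∅ := by
    ext y
    simp only [mem_inter_iff, mem_preimage, mem_compl_iff, mem_empty_iff_false, iff_false, not_and]
    exact fun h1 h2 => h1 ((chart n p).map_target h2)
  rw [this]
  simp

lemma chartVolume_restrict_inter (p q : Ω) :
    (chartVolume g p).restrict ((chart n p).source ∩ (chart n q).source) =
      (chartVolume g q).restrict ((chart n p).source ∩ (chart n q).source) := by
  refine map_withDensity_restrict_eq (measurableSet_target p) (measurableSet_target q)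
    (continuousOn_extChartAt_symm p) (continuousOn_extChartAt_symm q)
    ((measurableSet_source p).inter (measurableSet_source q)) (T := trans n p q)
    (J := dTrans n p q) ?_ (injOn_symm p) (injOn_symm q) ?_ ?_ ?_
  · exact fun y hy hA => ⟨(trans_mem ⟨hy, hA.2⟩).1, symm_trans ⟨hy, hA.2⟩⟩
  · exact fun y' _ hA => ⟨_, (chart n p).map_source hA.1, (chart n p).left_inv hA.1⟩
  · exact fun y hy hA => (hasFDerivWithinAt_trans ⟨hy, hA.2⟩).mono
      (extChartAt_target_subset_range p)
  · intro y hy hA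
    rw [density_eq_trans g ⟨hy, hA.2⟩, ENNReal.ofReal_mul (abs_nonneg _)]

lemma chartBoundaryVolume_restrict_inter (p q : Ω) :
    (chartBoundaryVolume g p).restrict ((chart n p).source ∩ (chart n q).source) =
      (chartBoundaryVolume g q).restrict ((chart n p).source ∩ (chart n q).source) := by
  refine map_withDensity_restrict_eq (measurableSet_faceTarget p) (measurableSet_faceTarget q)
    (continuousOn_symm_face p) (continuousOn_symm_face q)
    ((measurableSet_source p).inter (measurableSet_source q)) (T := transFace n p q)
    (J := dTransFace n p q) ?_ (injOn_symm_face p) (injOn_symm_face q) ?_ ?_ ?_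
  · intro z hz hA
    have hz' : face z ∈ overlap n p q := ⟨hz, hA.2⟩
    simp only [mem_preimage, face_transFace hz']
    exact ⟨(trans_mem hz').1, symm_trans hz'⟩
  · intro z' hz' hA
    have h1 : face z' ∈ overlap n q p := ⟨hz', hA.1⟩
    refine ⟨transFace n q p z', ?_, ?_⟩
    · simp only [mem_preimage, face_transFace h1]
      exact (trans_mem h1).1
    · simp only [face_transFace h1]
      exact symm_trans h1
  · exact fun z hz hA => (hasFDerivAt_transFace ⟨hz, hA.2⟩).hasFDerivWithinAt
  · intro z hz hA
    rw [boundaryDensity_eq_trans g ⟨hz, hA.2⟩, ENNReal.ofReal_mul (abs_nonneg _)]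

lemma volΩ_restrict_source (p : Ω) : (volΩ g).restrict (chart n p).source = chartVolume g p :=
  restrict_iSup_eq_of_restrict_inter_eq measurableSet_source (chartVolume_compl_source g)
    (chartVolume_restrict_inter g) p

lemma volBdry_restrict_source (p : Ω) :
    (volBdry g).restrict (chart n p).source = chartBoundaryVolume g p :=
  restrict_iSup_eq_of_restrict_inter_eq measurableSet_source (chartBoundaryVolume_compl_source g)
    (chartBoundaryVolume_restrict_inter g) p

lemma volΩ_apply_of_subset (p : Ω) {B : Set Ω} (hB : MeasurableSet B) (h : B ⊆ (chart n p).source) :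
    volΩ g B = ∫⁻ y in (chart n p).symm ⁻¹' B ∩ (chart n p).target,
      ENNReal.ofReal (density g p y) := by
  rw [← Measure.restrict_eq_self (volΩ g) h, volΩ_restrict_source, chartVolume,
    map_withDensity_apply (measurableSet_target p) (continuousOn_extChartAt_symm p) _ hB]

lemma volBdry_apply_of_subset (p : Ω) {B : Set Ω} (hB : MeasurableSet B)
    (h : B ⊆ (chart n p).source) :
    volBdry g B = ∫⁻ z in (fun z => (chart n p).symm (face z)) ⁻¹' B ∩ face ⁻¹' (chart n p).target,
      ENNReal.ofReal (boundaryDensity g p z) := by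
  rw [← Measure.restrict_eq_self (volBdry g) h, volBdry_restrict_source, chartBoundaryVolume,
    map_withDensity_apply (measurableSet_faceTarget p) (continuousOn_symm_face p) _ hB]

lemma exists_isOpen_volΩ_lt_top (x : Ω) : ∃ U, IsOpen U ∧ x ∈ U ∧ volΩ g U < ⊤ := by
  obtain ⟨V, hV, hyV, h⟩ := exists_isOpen_setLIntegral_lt_top volume (measurableSet_target x)
    (contDiffOn_density g x).continuousOn (mem_extChartAt_target x)
  have hU := isOpen_extChartAt_preimage' (I := 𝓡∂ (n + 1)) x hV
  refine ⟨_, hU, ⟨mem_extChartAt_source x, hyV⟩, ?_⟩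
  rw [volΩ_apply_of_subset g x hU.measurableSet inter_subset_left]
  refine (lintegral_mono_set fun y hy => (⟨?_, hy.2⟩ : y ∈ V ∩ (chart n x).target)).trans_lt h
  have := hy.1.2
  rwa [mem_preimage, (chart n x).right_inv hy.2] at this

/-- A point with positive first coordinate has a neighbourhood that misses the boundary; near a
boundary point the continuous density is bounded. -/
lemma exists_isOpen_volBdry_lt_top (x : Ω) : ∃ U, IsOpen U ∧ x ∈ U ∧ volBdry g U < ⊤ := by
  have hx : 0 ≤ chart n x x 0 := target_subset x (mem_extChartAt_target x)
  rcases hx.lt_or_eq with h0 | h0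
  · have hU := isOpen_extChartAt_preimage' (I := 𝓡∂ (n + 1)) x
      (isOpen_lt continuous_const (by fun_prop) : IsOpen {y : Coord n | 0 < y 0})
    refine ⟨_, hU, ⟨mem_extChartAt_source x, h0⟩, ?_⟩
    rw [volBdry_apply_of_subset g x hU.measurableSet inter_subset_left]
    convert ENNReal.zero_lt_top
    refine setLIntegral_measure_zero _ _ (measure_mono_null ?_ measure_empty)
    intro z hz
    have := hz.1.2
    rw [mem_preimage, (chart n x).right_inv hz.2] at this
    exact (lt_irrefl (0 : ℝ) this).elim
  · have hface : face (tailL n (chart n x x)) = chart n x x := face_tailL h0.symm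
    obtain ⟨V, hV, hyV, h⟩ := exists_isOpen_setLIntegral_lt_top volume (measurableSet_faceTarget x)
      (continuousOn_boundaryDensity g x) (y := tailL n (chart n x x))
      (by rw [mem_preimage, hface]; exact mem_extChartAt_target x)
    have hU := isOpen_extChartAt_preimage' (I := 𝓡∂ (n + 1)) x (hV.preimage (tailL n).continuous)
    refine ⟨_, hU, ⟨mem_extChartAt_source x, hyV⟩, ?_⟩
    rw [volBdry_apply_of_subset g x hU.measurableSet inter_subset_left]
    refine (lintegral_mono_set fun z hz =>
      (⟨?_, hz.2⟩ : z ∈ V ∩ face ⁻¹' (chart n x).target)).trans_lt h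
    have := hz.1.2
    rwa [mem_preimage, (chart n x).right_inv hz.2, mem_preimage, tailL_face] at this

lemma volΩ_univ_lt_top [CompactSpace Ω] : volΩ g univ < ⊤ := by
  refine isCompact_univ.measure_lt_top_of_nhdsWithin fun x _ => ?_
  obtain ⟨U, hU, hx, h⟩ := exists_isOpen_volΩ_lt_top g x
  exact ⟨U, mem_nhdsWithin_of_mem_nhds (hU.mem_nhds hx), h⟩

lemma volBdry_univ_lt_top [CompactSpace Ω] : volBdry g univ < ⊤ := by
  refine isCompact_univ.measure_lt_top_of_nhdsWithin fun x _ => ?_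
  obtain ⟨U, hU, hx, h⟩ := exists_isOpen_volBdry_lt_top g x
  exact ⟨U, mem_nhdsWithin_of_mem_nhds (hU.mem_nhds hx), h⟩

/-- Every point of the half space is a limit of interior points, so in a chart a nonempty open set
contains a set with nonempty interior in the full coordinate space, and there the density is
positive. -/
lemma volΩ_ne_zero_of_isOpen {U : Set Ω} (hU : IsOpen U) (hne : U.Nonempty) : volΩ g U ≠ 0 := by
  obtain ⟨p, hp⟩ := hne
  have hV : (chart n p).target ∩ (chart n p).symm ⁻¹' U ∈ 𝓝[range (𝓡∂ (n + 1))] (chart n p p) := by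
    refine Filter.inter_mem (target_mem_nhdsWithin (mem_extChartAt_target p)) ?_
    have h := continuousOn_extChartAt_symm (I := 𝓡∂ (n + 1)) p _ (mem_extChartAt_target p)
      (hU.mem_nhds (by rwa [extChartAt_to_inv]))
    rwa [Filter.mem_map, nhdsWithin_extChartAt_target_eq_of_mem (mem_extChartAt_target p)] at h
  obtain ⟨O, hO, hpO, hOV⟩ := mem_nhdsWithin.1 hV
  have hm : MeasurableSet ((chart n p).target ∩ (chart n p).symm ⁻¹' U) :=
    measurableSet_inter_preimage (measurableSet_target p) (continuousOn_extChartAt_symm p)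
      hU.measurableSet
  refine fun h => setLIntegral_ofReal_ne_zero hm
    ((contDiffOn_density g p).continuousOn.mono inter_subset_left)
    (fun y hy => density_pos g hy.1) (μ := volume) ?_ ?_
  · obtain ⟨y, hyO, hy⟩ := mem_closure_iff.1 ((𝓡∂ (n + 1)).range_subset_closure_interior
      (range_mem (mem_extChartAt_target p))) O hO hpO
    exact (Measure.measure_pos_of_mem_nhds volume (Filter.mem_of_superset
      (Filter.inter_mem (hO.mem_nhds hyO) (mem_interior_iff_mem_nhds.1 hy)) hOV)).ne'
  · have h1 := volΩ_apply_of_subset g p ((measurableSet_source p).inter hU.measurableSet)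
      inter_subset_left
    rw [measure_mono_null inter_subset_right h] at h1
    rw [h1]
    congr 2
    ext y
    exact ⟨fun hy => ⟨⟨(chart n p).map_target hy.1, hy.2⟩, hy.1⟩, fun hy => ⟨hy.2, hy.1.2⟩⟩

lemma volBdry_univ_pos (h : ((𝓡∂ (n + 1)).boundary Ω).Nonempty) : volBdry g univ ≠ 0 := by
  obtain ⟨p, hp⟩ := h
  have h0 : chart n p p 0 = 0 := by
    rw [← isBoundaryPoint_symm_iff (mem_extChartAt_target p), extChartAt_to_inv]
    exact hp
  refine fun h => setLIntegral_ofReal_ne_zero (measurableSet_faceTarget p)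
    (continuousOn_boundaryDensity g p) (fun y hy => boundaryDensity_pos g hy) (μ := volume) ?_ ?_
  · refine (Measure.measure_pos_of_mem_nhds volume ((isOpen_faceTarget p).mem_nhds
      (x := tailL n (chart n p p)) ?_)).ne'
    rw [mem_preimage, face_tailL h0]
    exact mem_extChartAt_target p
  · have h1 := volBdry_apply_of_subset g p (measurableSet_source p) subset_rfl
    rw [measure_mono_null (subset_univ _) h] at h1
    rw [h1]
    congr 2
    ext y
    exact ⟨fun hy => ⟨(chart n p).map_target hy, hy⟩, fun hy => hy.2⟩

end Volume

end RiemannianBoundary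

namespace RiemannianBoundary

/-! ### Locally Lipschitz functions -/

lemma locallyLipschitzOn_comp {α β γ : Type*} [PseudoMetricSpace α] [PseudoMetricSpace β]
    [PseudoMetricSpace γ] {f : β → γ} {k : α → β} {s : Set α} {t : Set β}
    (hf : LocallyLipschitzOn t f) (hk : LocallyLipschitzOn s k) (hst : MapsTo k s t) :
    LocallyLipschitzOn s (f ∘ k) := by
  intro x hx
  obtain ⟨K, u, hu, hfu⟩ := hf (hst hx)
  obtain ⟨K', v, hv, hkv⟩ := hk hx
  have ht : Filter.Tendsto k (𝓝[s] x) (𝓝[t] (k x)) :=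
    (hk.continuousOn x hx).tendsto_nhdsWithin hst
  exact ⟨K * K', v ∩ k ⁻¹' u, Filter.inter_mem hv (ht hu),
    hfu.comp (hkv.mono inter_subset_left) fun _ h => h.2⟩

lemma locallyLipschitzOn_mul {α : Type*} [PseudoMetricSpace α] {f k : α → ℝ} {s : Set α}
    (hf : LocallyLipschitzOn s f) (hk : LocallyLipschitzOn s k) :
    LocallyLipschitzOn s fun x => f x * k x := by
  have h1 : LocallyLipschitz fun p : ℝ × ℝ => p.1 * p.2 :=
    (contDiff_fst.mul contDiff_snd : ContDiff ℝ 1 fun p : ℝ × ℝ => p.1 * p.2).locallyLipschitz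
  have h2 : LocallyLipschitzOn s fun x => (f x, k x) := by
    intro x hx
    obtain ⟨K, u, hu, hfu⟩ := hf hx
    obtain ⟨K', v, hv, hkv⟩ := hk hx
    exact ⟨max K K', u ∩ v, Filter.inter_mem hu hv,
      (hfu.mono inter_subset_left).prodMk (hkv.mono inter_subset_right)⟩
  exact locallyLipschitzOn_comp (h1.locallyLipschitzOn (s := univ)) h2 (mapsTo_univ _ _)

/-- Rademacher's theorem applied near each point; being a null set is a local property. Boundary
points of `s` are excluded because the derivative is two-sided. -/
lemma ae_differentiableAt_of_locallyLipschitzOn {E F : Type*} [NormedAddCommGroup E]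
    [NormedSpace ℝ E] [FiniteDimensional ℝ E] [MeasurableSpace E] [BorelSpace E]
    [NormedAddCommGroup F] [NormedSpace ℝ F] [FiniteDimensional ℝ F] (μ : Measure E)
    [μ.IsAddHaarMeasure] {f : E → F} {s : Set E} (hf : LocallyLipschitzOn s f) :
    ∀ᵐ x ∂μ, s ∈ 𝓝 x → DifferentiableAt ℝ f x := by
  refine measure_null_of_locally_null _ fun x hx => ?_
  simp only [mem_compl_iff, mem_ofPred_eq, Classical.not_imp] at hx
  obtain ⟨K, t, ht, hft⟩ := hf (mem_of_mem_nhds hx.1)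
  rw [nhdsWithin_eq_nhds.2 hx.1] at ht
  have h1 := (hft.mono interior_subset).ae_differentiableWithinAt_of_mem (μ := μ)
  refine ⟨interior t ∩ {x | ¬ (x ∈ interior t → DifferentiableWithinAt ℝ f (interior t) x)}, ?_,
    measure_mono_null inter_subset_right h1⟩
  refine mem_nhdsWithin.2 ⟨interior t, isOpen_interior, mem_interior_iff_mem_nhds.2 ht, ?_⟩
  intro z hz
  refine ⟨hz.1, fun h => hz.2 fun _ => ?_⟩
  exact (h hz.1).differentiableAt (isOpen_interior.mem_nhds hz.1)

variable {n : ℕ}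

/-- The reflection-type retraction `(t, z) ↦ (|t|, z)` of `ℝ^(n+1)` onto the half space. -/
def foldCoord (y : Coord n) : Coord n := consCoord (|y 0|, tailL n y)

@[simp] lemma foldCoord_zero (y : Coord n) : foldCoord y 0 = |y 0| := rfl

@[simp] lemma foldCoord_succ (y : Coord n) (i : Fin n) : foldCoord y i.succ = y i.succ := rfl

lemma foldCoord_of_nonneg {y : Coord n} (hy : 0 ≤ y 0) : foldCoord y = y :=
  coord_ext (by simp [abs_of_nonneg hy]) fun i => by simp

lemma lipschitzWith_foldCoord : LipschitzWith 1 (foldCoord : Coord n → Coord n) := by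
  refine LipschitzWith.of_dist_le_mul fun x y => ?_
  rw [NNReal.coe_one, one_mul, EuclideanSpace.dist_eq, EuclideanSpace.dist_eq]
  refine Real.sqrt_le_sqrt ?_
  simp only [Fin.sum_univ_succ, foldCoord_zero, foldCoord_succ]
  gcongr
  exact abs_abs_sub_abs_le_abs_sub _ _

lemma norm_foldCoord (y : Coord n) : ‖foldCoord y‖ = ‖y‖ := by
  simp [EuclideanSpace.norm_eq, Fin.sum_univ_succ]

lemma trace_eq_sum (A : Coord n →L[ℝ] Coord n) :
    LinearMap.trace ℝ (Coord n) A = ∑ i, A (EuclideanSpace.single i 1) i := by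
  rw [LinearMap.trace_eq_matrix_trace ℝ (EuclideanSpace.basisFun _ ℝ).toBasis]
  simp [Matrix.trace, LinearMap.toMatrix_apply]

lemma trace_fderiv_eq_sum {W : Coord n → Coord n} {y : Coord n} (hW : DifferentiableAt ℝ W y) :
    LinearMap.trace ℝ (Coord n) (fderiv ℝ W y) =
      ∑ i, fderiv ℝ (fun y => W y i) y (EuclideanSpace.single i 1) := by
  rw [trace_eq_sum]
  refine Finset.sum_congr rfl fun i _ => ?_
  have h := ((EuclideanSpace.proj i : Coord n →L[ℝ] ℝ).hasFDerivAt.comp y hW.hasFDerivAt).fderiv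
  change fderiv ℝ (fun y => W y i) y = _ at h
  rw [h]
  rfl

lemma ae_zero_ne (i : Fin (n + 1)) : ∀ᵐ y : Coord n, y i ≠ 0 := by
  have h := Measure.addHaar_submodule (volume : Measure (Coord n))
    (LinearMap.ker ((EuclideanSpace.proj i : Coord n →L[ℝ] ℝ) : Coord n →ₗ[ℝ] ℝ)) (fun h => by
      have h1 : (EuclideanSpace.single i (1 : ℝ) : Coord n) ∈ (⊤ : Submodule ℝ (Coord n)) :=
        Submodule.mem_top
      rw [← h] at h1
      simp at h1)
  filter_upwards [measure_eq_zero_iff_ae_notMem.1 h] with y hy h0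
  exact hy (by simpa using h0)

/-! ### The divergence in a chart -/

section Divergence

variable {Ω : Type*} [TopologicalSpace Ω] [ChartedSpace (EuclideanHalfSpace (n + 1)) Ω]
  [IsManifold (𝓡∂ (n + 1)) ∞ Ω] (g : Metric n Ω) {X : ∀ x : Ω, TangentSpace (𝓡∂ (n + 1)) x}

/-- The components of `√det(g) X` in the chart around `p`. -/
def densityField (X : ∀ x : Ω, TangentSpace (𝓡∂ (n + 1)) x) (p : Ω) (y : Coord n) : Coord n :=
  density g p y • chartField X p y

/-- The field transforms by the Jacobian and the density by the inverse of its absolute determinant.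
Together this is the Piola transform, the hypothesis of `trace_fderiv_of_piola`. -/
lemma densityField_trans {p q : Ω} {y : Coord n} (hy : y ∈ overlap n p q) :
    densityField g X q (trans n p q y) =
      |(dTrans n p q y).det|⁻¹ • dTrans n p q y (densityField g X p y) := by
  have h0 : |(dTrans n p q y).det| ≠ 0 := fun h => by
    have := density_eq_trans g hy
    rw [h, zero_mul] at this
    exact (density_pos g hy.1).ne' this
  rw [densityField, densityField, chartField_trans X hy, density_eq_trans g hy, map_smul, smul_smul]
  congr 1
  field_simp

lemma differentiableAt_density {p : Ω} {y : Coord n} (hy : y ∈ (chart n p).target) (h0 : 0 < y 0) :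
    DifferentiableAt ℝ (density g p) y :=
  ((contDiffOn_density g p).contDiffAt (target_mem_nhds hy h0)).differentiableAt (by simp)

/-- The divergence is given by the same formula in all charts. -/
lemma divergence_symm {p : Ω} {y : Coord n} (hy : y ∈ (chart n p).target) (h0 : 0 < y 0)
    (hX : DifferentiableAt ℝ (chartField X p) y) :
    divergence g X ((chart n p).symm y) = (density g p y)⁻¹ *
      ∑ i, fderiv ℝ (fun y => densityField g X p y i) y (EuclideanSpace.single i 1) := by
  -- `divergence` at `x` is computed in the preferred chart at `x`; the Piola identity compares it
  -- with the fixed chart around `p`. Since `y 0 > 0`, derivatives within the half space are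
  -- ordinary derivatives.
  set x := (chart n p).symm y with hx
  have hyo : y ∈ overlap n p x := ⟨hy, mem_extChartAt_source x⟩
  have hy' : trans n p x y = chart n x x := rfl
  have hev : ∀ᶠ z in 𝓝 y, z ∈ overlap n p x ∧ 0 < z 0 := by
    refine Filter.Eventually.and ?_ ((isOpen_lt continuous_const (by fun_prop)).mem_nhds h0)
    have := overlap_mem_nhdsWithin hyo
    rwa [nhdsWithin_eq_nhds.2 (range_mem_nhds h0)] at this
  have hfd : ∀ z ∈ overlap n p x, 0 < z 0 → HasFDerivAt (trans n p x) (dTrans n p x z) z :=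
    fun z hz hz0 => (hasFDerivWithinAt_trans hz).hasFDerivAt (range_mem_nhds hz0)
  have h0' : 0 < trans n p x y 0 := trans_zero_pos hyo h0
  have hyo' := trans_mem hyo
  have hfd' : HasFDerivAt (trans n x p) (dTrans n x p (trans n p x y)) (trans n p x y) :=
    (hasFDerivWithinAt_trans hyo').hasFDerivAt (range_mem_nhds h0')
  have hVd : DifferentiableAt ℝ (densityField g X p) y := (differentiableAt_density g hy h0).smul hX
  have hJ2 := dTrans_comp_dTrans hyo'
  rw [trans_trans hyo] at hJ2
  obtain ⟨hWd, htr⟩ := trace_fderiv_of_piola (T := trans n p x) (S := trans n x p)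
    (V := densityField g X p) (W := densityField g X x) (y := y)
    (J' := dTrans n x p (trans n p x y))
    (((contDiffWithinAt_trans hyo).contDiffAt (range_mem_nhds h0)).of_le (by norm_cast))
    (by rw [(hfd y hyo h0).fderiv]; exact hJ2)
    (by rw [(hfd y hyo h0).fderiv]; exact dTrans_comp_dTrans hyo)
    hVd hfd'.differentiableAt (trans_trans hyo)
    (by
      have := overlap_mem_nhdsWithin hyo'
      rw [nhdsWithin_eq_nhds.2 (range_mem_nhds h0')] at this
      filter_upwards [this] with w hw using trans_trans hw)
    (by
      filter_upwards [hev] with z hz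
      rw [(hfd z hz.1 hz.2).fderiv, densityField_trans g hz.1])
  rw [trace_fderiv_eq_sum hWd, trace_fderiv_eq_sum hVd, (hfd y hyo h0).fderiv] at htr
  rw [divergence, ← hy', density_eq_trans g hyo, mul_inv, mul_right_comm, ← htr, mul_comm]
  congr 1
  refine Finset.sum_congr rfl fun i _ => ?_
  rw [fderivWithin_of_mem_nhds (range_mem_nhds h0')]
  rfl

end Divergence

end RiemannianBoundary

/-! ### Integration against a parametrized measure, and the flux density at the boundary -/

namespace RiemannianBoundary

/-- Integration of a function against a parametrized measure. -/
lemma integral_map_withDensity {E Ω : Type*} [TopologicalSpace E] [MeasurableSpace E]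
    [BorelSpace E] [TopologicalSpace Ω] [MeasurableSpace Ω] [BorelSpace Ω]
    {vol : Measure E} {e : E → Ω} {S : Set E} (hS : MeasurableSet S)
    (he : ContinuousOn e S) {ρ : E → ℝ} (hρ : ContinuousOn ρ S) (hpos : ∀ y ∈ S, 0 < ρ y)
    {κ : Ω → E} {U : Set Ω} (hU : MeasurableSet U)
    (hκ : ContinuousOn κ U) (heU : MapsTo e S U) (hκS : MapsTo κ U S)
    (hκe : ∀ y ∈ S, κ (e y) = y) (heκ : ∀ x ∈ U, e (κ x) = x) {k : Ω → ℝ} {G : E → ℝ}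
    (hG : Measurable G) (hk : ∀ᵐ y ∂vol, y ∈ S → ρ y * k (e y) = G y)
    (hGi : IntegrableOn G S vol) :
    Integrable k (Measure.map e ((vol.restrict S).withDensity fun y => ENNReal.ofReal (ρ y))) ∧
      ∫ x, k x ∂(Measure.map e ((vol.restrict S).withDensity fun y => ENNReal.ofReal (ρ y))) =
        ∫ y in S, G y ∂vol := by
  classical
  set ν := (vol.restrict S).withDensity fun y => ENNReal.ofReal (ρ y) with hν
  have hem : AEMeasurable e ν := aemeasurable_param hS he _
  have hD : Measurable (S.piecewise ρ 0) := hρ.measurable_piecewise continuousOn_const hS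
  -- Measurability of `k` is not assumed. This function, obtained by transporting `G / ρ` through
  -- `κ`, is a measurable representative of it.
  have hκm : Measurable (U.piecewise (fun x => (S.piecewise ρ 0 (κ x))⁻¹ * G (κ x)) 0) := by
    have h1 : Measurable fun u : U => (S.piecewise ρ 0 (κ u))⁻¹ * G (κ u) :=
      ((hD.inv.mul hG).comp (continuousOn_iff_continuous_domRestrict.1 hκ).measurable)
    refine measurable_of_restrict_of_restrict_compl hU ?_ ?_
    · rw [Set.domRestrict_piecewise]
      exact h1
    · rw [Set.domRestrict_piecewise_compl]
      exact measurable_const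
  have hkae : k =ᵐ[Measure.map e ν] U.piecewise (fun x => (S.piecewise ρ 0 (κ x))⁻¹ * G (κ x)) 0 := by
    refine ae_map_withDensity hS he hU hκ heU hκS hκe heκ ?_
    filter_upwards [hk] with y hy hyS
    rw [piecewise_eq_of_mem _ _ _ (heU hyS), hκe y hyS, piecewise_eq_of_mem _ _ _ hyS, ← hy hyS,
      inv_mul_cancel_left₀ (hpos y hyS).ne']
  have hkm : AEStronglyMeasurable k (Measure.map e ν) := ⟨_, hκm.stronglyMeasurable, hkae⟩
  have hρm : AEMeasurable (fun y => ENNReal.ofReal (ρ y)) (vol.restrict S) :=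
    (hρ.aemeasurable hS).ennreal_ofReal
  have hcongr : (fun y => (ENNReal.ofReal (ρ y)).toReal • k (e y)) =ᵐ[vol.restrict S] G := by
    refine (ae_restrict_iff' hS).2 ?_
    filter_upwards [hk] with y hy hyS
    rw [ENNReal.toReal_ofReal (hpos y hyS).le, smul_eq_mul, hy hyS]
  constructor
  · rw [integrable_map_measure hkm hem, hν,
      integrable_withDensity_iff_integrable_smul₀' hρm (ae_of_all _ fun _ => ENNReal.ofReal_lt_top)]
    exact hGi.congr hcongr.symm
  · rw [integral_map hem hkm, hν, integral_withDensity_eq_integral_toReal_smul₀ hρm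
      (ae_of_all _ fun _ => ENNReal.ofReal_lt_top)]
    exact integral_congr_ae hcongr

section Stokes

variable {n : ℕ} {Ω : Type*} [TopologicalSpace Ω] [ChartedSpace (EuclideanHalfSpace (n + 1)) Ω]
  [IsManifold (𝓡∂ (n + 1)) ∞ Ω] (g : Metric n Ω) {X : ∀ x : Ω, TangentSpace (𝓡∂ (n + 1)) x}

/-! ### The boundary flux -/

/-- Raising an index in coordinates: the components of `sharp` solve the linear system with the Gram
matrix as matrix and the components `b` of the covector as right-hand side. -/
lemma gram_mulVec_chart_sharp {p : Ω} {y : Coord n} (hy : y ∈ (chart n p).target)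
    (α : Module.Dual ℝ (TangentSpace (𝓡∂ (n + 1)) ((chart n p).symm y))) {b : Fin (n + 1) → ℝ}
    (hα : ∀ w : Coord n, α (dParam n p y w) = b ⬝ᵥ (w : Fin (n + 1) → ℝ)) :
    (gram g p y).mulVec (dChart n p ((chart n p).symm y) (sharp g _ α)) = b := by
  have h1 : ∀ w : Coord n, metricAt g ((chart n p).symm y) (sharp g _ α) (dParam n p y w) =
      b ⬝ᵥ (w : Fin (n + 1) → ℝ) := fun w => (inner_sharp g _ α _).trans (hα w)
  have h2 := (posDef_gram g hy).isHermitian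
  set s := dChart n p ((chart n p).symm y) (sharp g _ α) with hs
  have h3 : dParam n p y s = sharp g _ α := dParam_dChart hy _
  rw [← h3] at h1
  ext i
  have h4 := h1 (EuclideanSpace.single i 1)
  rw [metricAt_symm, metricAt_dParam] at h4
  simpa using h4

/-- Cramer's rule: multiply by the adjugate, whose (0,0) entry is the complementary minor. -/
lemma det_mul_apply_zero_of_mulVec_eq {A : Matrix (Fin (n + 1)) (Fin (n + 1)) ℝ}
    {s : Fin (n + 1) → ℝ} {c : ℝ} (h : A.mulVec s = Pi.single 0 c) :
    A.det * s 0 = (A.submatrix Fin.succ Fin.succ).det * c := by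
  have h1 : A.adjugate.mulVec (A.mulVec s) = A.det • s := by
    rw [Matrix.mulVec_mulVec, Matrix.adjugate_mul, Matrix.smul_mulVec, Matrix.one_mulVec]
  rw [h] at h1
  have h2 := congrFun h1 0
  rw [Matrix.mulVec_single] at h2
  have h3 := Matrix.adjugate_fin_succ_eq_det_submatrix A 0 0
  simp only [Matrix.col_apply, Pi.smul_apply, h3] at h2
  simpa using h2.symm

/-- The flux density through the boundary, in boundary coordinates. -/
lemma boundaryDensity_mul_inner_outwardNormal (X : ∀ x : Ω, TangentSpace (𝓡∂ (n + 1)) x) {p : Ω}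
    {z : EuclideanSpace ℝ (Fin n)} (hz : face z ∈ (chart n p).target) :
    boundaryDensity g p z * g.inner ((chart n p).symm (face z)) (X _) (outwardNormal g _) =
      -densityField g X p (face z) 0 := by
  set y := face z with hy0
  set x := (chart n p).symm y with hx
  have hyo : y ∈ overlap n p x := ⟨hz, mem_extChartAt_source x⟩
  -- `firstCoord` refers to the preferred chart at `x`; in the chart around `p` it is `c` times the
  -- differential of the first coordinate.
  obtain ⟨c, hc, h1⟩ := exists_dTrans_apply_zero_eq hyo (face_zero z)
  have h2 : ∀ w : Coord n, firstCoord x (dParam n p y w) = c * w 0 := fun w => by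
    rw [← h1, dTrans, ContinuousLinearMap.comp_apply, ← hx, dChart_self]
    rfl
  have h3 := gram_mulVec_chart_sharp g hz (firstCoord x) (b := Pi.single 0 c) fun w => by
    rw [h2]; simp
  have h4 := det_mul_apply_zero_of_mulVec_eq h3
  set s := dChart n p x (sharp g x (firstCoord x)) with hs
  have hsd : dParam n p y s = sharp g x (firstCoord x) := dParam_dChart hz _
  have h5 : normSq g x (sharp g x (firstCoord x)) = c * s 0 := by
    rw [normSq, inner_sharp, ← h2, hsd]
  have h6 : g.inner x (X x) (sharp g x (firstCoord x)) = c * chartField X p y 0 := by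
    rw [g.symm, inner_sharp, ← h2, dParam_chartField X hz]
  have hd := (posDef_gram g hz).det_pos
  have hm := (posDef_gram_submatrix g hz).det_pos
  have h7 : s 0 = ((gram g p y).submatrix Fin.succ Fin.succ).det * c / (gram g p y).det := by
    rw [eq_div_iff hd.ne', ← h4, mul_comm]
  -- The length of the conormal is `c` times the ratio of the two densities, so both `c` and the
  -- boundary density cancel in the flux.
  have h8 : √(normSq g x (sharp g x (firstCoord x))) =
      c * (boundaryDensity g p z / density g p y) := by
    rw [h5, h7, boundaryDensity, density, ← Real.sqrt_div hm.le]
    rw [show c * (((gram g p y).submatrix Fin.succ Fin.succ).det * c / (gram g p y).det) =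
      c ^ 2 * (((gram g p y).submatrix Fin.succ Fin.succ).det / (gram g p y).det) by ring,
      Real.sqrt_mul (sq_nonneg c), Real.sqrt_sq hc.le]
  have h9 := boundaryDensity_pos g hz
  have h10 := density_pos g hz
  rw [outwardNormal, map_neg, map_smul, h6, h8, densityField]
  simp only [smul_eq_mul, PiLp.smul_apply]
  field_simp

end Stokes

end RiemannianBoundary

namespace RiemannianBoundary

section Stokes

variable {n : ℕ} {Ω : Type*} [TopologicalSpace Ω] [ChartedSpace (EuclideanHalfSpace (n + 1)) Ω]
  {h : Ω → ℝ}

/-- The support of `h` in the chart around `p`. -/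
def chartSupport (h : Ω → ℝ) (p : Ω) : Set (Coord n) := chart n p '' tsupport h

lemma isCompact_chartSupport [CompactSpace Ω] {p : Ω} (hp : tsupport h ⊆ (chart n p).source) :
    IsCompact (chartSupport (n := n) h p) :=
  (isClosed_tsupport h).isCompact.image_of_continuousOn ((continuousOn_extChartAt p).mono hp)

lemma chartSupport_subset {p : Ω} (hp : tsupport h ⊆ (chart n p).source) :
    chartSupport (n := n) h p ⊆ (chart n p).target := by
  rintro _ ⟨x, hx, rfl⟩
  exact (chart n p).map_source (hp hx)

lemma symm_notMem_tsupport {p : Ω} {y : Coord n} (hy : y ∈ (chart n p).target)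
    (hyK : y ∉ chartSupport (n := n) h p) : (chart n p).symm y ∉ tsupport h :=
  fun hx => hyK ⟨_, hx, (chart n p).right_inv hy⟩

variable [IsManifold (𝓡∂ (n + 1)) ∞ Ω] (g : Metric n Ω)
  {X : ∀ x : Ω, TangentSpace (𝓡∂ (n + 1)) x}

/-! ### The divergence theorem in a chart -/

lemma contDiffWithinAt_comp_symm (hh : ContMDiff (𝓡∂ (n + 1)) 𝓘(ℝ, ℝ) 1 h) {p : Ω} {y : Coord n}
    (hy : y ∈ (chart n p).target) :
    ContDiffWithinAt ℝ 1 (fun y => h ((chart n p).symm y)) (range (𝓡∂ (n + 1))) y := by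
  have h1 : ContMDiffOn 𝓘(ℝ, Coord n) 𝓘(ℝ, ℝ) 1 (h ∘ (chart n p).symm) (chart n p).target :=
    hh.comp_contMDiffOn (contMDiffOn_extChartAt_symm p)
  have h2 := (contMDiffOn_iff_contDiffOn.1 h1) y hy
  exact h2.mono_of_mem_nhdsWithin (target_mem_nhdsWithin hy)

variable (n) in
/-- The differential of `h` at `x`, as a continuous functional on `ℝ^(n+1)`. -/
def dFun (h : Ω → ℝ) (x : Ω) : Coord n →L[ℝ] ℝ := mfderiv (𝓡∂ (n + 1)) 𝓘(ℝ, ℝ) h x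

lemma hasFDerivWithinAt_comp_symm (hh : ContMDiff (𝓡∂ (n + 1)) 𝓘(ℝ, ℝ) 1 h) {p : Ω} {y : Coord n}
    (hy : y ∈ (chart n p).target) :
    HasFDerivWithinAt (fun y => h ((chart n p).symm y))
      (dFun n h ((chart n p).symm y) ∘L dParam n p y)
      (range (𝓡∂ (n + 1))) y := by
  have h1 : HasMFDerivWithinAt 𝓘(ℝ, Coord n) (𝓡∂ (n + 1)) (chart n p).symm
      (range (𝓡∂ (n + 1))) y (dParam n p y) :=
    (mdifferentiableWithinAt_extChartAt_symm hy).hasMFDerivWithinAt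
  have h2 : HasMFDerivAt (𝓡∂ (n + 1)) 𝓘(ℝ, ℝ) h ((chart n p).symm y)
      (dFun n h ((chart n p).symm y)) :=
    (hh.mdifferentiable (by simp) ((chart n p).symm y)).hasMFDerivAt
  exact (h2.comp_hasMFDerivWithinAt y h1).hasFDerivWithinAt

lemma differential_symm_apply (hh : ContMDiff (𝓡∂ (n + 1)) 𝓘(ℝ, ℝ) 1 h) {p : Ω} {y : Coord n}
    (hy : y ∈ (chart n p).target) :
    differential h ((chart n p).symm y) (X ((chart n p).symm y)) =
      fderivWithin ℝ (fun y => h ((chart n p).symm y)) (range (𝓡∂ (n + 1))) y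
        (chartField X p y) := by
  rw [(hasFDerivWithinAt_comp_symm hh hy).fderivWithin
    ((𝓡∂ (n + 1)).uniqueDiffOn y (range_mem hy)), ContinuousLinearMap.comp_apply,
    dParam_chartField X hy]
  rfl

/-- The `i`-th component of `√det(g) h X` in the chart around `p`, extended by zero and by
reflection to the whole space. -/
def localComp (X : ∀ x : Ω, TangentSpace (𝓡∂ (n + 1)) x) (h : Ω → ℝ) (p : Ω) (i : Fin (n + 1))
    (y : Coord n) : ℝ :=
  (chart n p).target.indicator (fun y => h ((chart n p).symm y) * densityField g X p y i)
    (foldCoord y)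

lemma indicator_eq_zero {p : Ω} {y : Coord n} (i : Fin (n + 1))
    (hy : y ∉ chartSupport (n := n) h p) :
    (chart n p).target.indicator
      (fun y => h ((chart n p).symm y) * densityField g X p y i) y = 0 := by
  by_cases ht : y ∈ (chart n p).target
  · rw [indicator_of_mem ht, image_eq_zero_of_notMem_tsupport (symm_notMem_tsupport ht hy), zero_mul]
  · exact indicator_of_notMem ht _

/-- The product rule for $\mathrm{div}(hX)$, multiplied by the density. In the open half space the
folding is the identity and plays no role. -/
lemma sum_lineDeriv_localComp (hh : ContMDiff (𝓡∂ (n + 1)) 𝓘(ℝ, ℝ) 1 h) {p : Ω}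
    {y : Coord n} (hy : y ∈ (chart n p).target) (h0 : 0 < y 0)
    (hX : DifferentiableAt ℝ (chartField X p) y) :
    ∑ i, lineDeriv ℝ (localComp g X h p i) y (EuclideanSpace.single i 1) =
      density g p y * (h ((chart n p).symm y) * divergence g X ((chart n p).symm y) +
        differential h ((chart n p).symm y) (X ((chart n p).symm y))) := by
  have hV : DifferentiableAt ℝ (densityField g X p) y := (differentiableAt_density g hy h0).smul hX
  have hhd : DifferentiableAt ℝ (fun y => h ((chart n p).symm y)) y :=
    ((contDiffWithinAt_comp_symm hh hy).contDiffAt (range_mem_nhds h0)).differentiableAt (by simp)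
  have hd := density_pos g hy
  have hVi : ∀ i, DifferentiableAt ℝ (fun y => densityField g X p y i) y := fun i =>
    (EuclideanSpace.proj i : Coord n →L[ℝ] ℝ).differentiableAt.comp y hV
  have key : ∀ i, lineDeriv ℝ (localComp g X h p i) y (EuclideanSpace.single i 1) =
      h ((chart n p).symm y) *
        fderiv ℝ (fun y => densityField g X p y i) y (EuclideanSpace.single i 1) +
      densityField g X p y i * fderiv ℝ (fun y => h ((chart n p).symm y)) y
        (EuclideanSpace.single i 1) := by
    intro i
    have h1 : localComp g X h p i =ᶠ[𝓝 y]
        fun y => h ((chart n p).symm y) * densityField g X p y i := by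
      filter_upwards [target_mem_nhds hy h0,
        (isOpen_lt continuous_const (by fun_prop) : IsOpen {y : Coord n | 0 < y 0}).mem_nhds h0]
        with z hz hz0
      rw [localComp, foldCoord_of_nonneg (le_of_lt hz0), indicator_of_mem hz]
    rw [h1.lineDeriv_eq, (hhd.fun_mul (hVi i)).lineDeriv_eq_fderiv, fderiv_fun_mul hhd (hVi i)]
    simp
  simp only [key]
  rw [Finset.sum_add_distrib, ← Finset.mul_sum, divergence_symm g hy h0 hX,
    differential_symm_apply hh hy, fderivWithin_of_mem_nhds (range_mem_nhds h0)]
  have h2 : fderiv ℝ (fun y => h ((chart n p).symm y)) y (chartField X p y) =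
      ∑ i, chartField X p y i *
        fderiv ℝ (fun y => h ((chart n p).symm y)) y (EuclideanSpace.single i 1) := by
    conv_lhs => rw [coord_eq_sum (chartField X p y)]
    simp
  rw [h2, mul_add, Finset.mul_sum _ _ (density g p y)]
  congr 1
  · field_simp
  · refine Finset.sum_congr rfl fun i _ => ?_
    simp only [densityField, PiLp.smul_apply, smul_eq_mul]
    ring

variable [CompactSpace Ω]

lemma hasCompactSupport_localComp {p : Ω} (hp : tsupport h ⊆ (chart n p).source)
    (i : Fin (n + 1)) : HasCompactSupport (localComp g X h p i) := by
  have hK := isCompact_chartSupport (n := n) hp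
  obtain ⟨R, hR⟩ := hK.isBounded.subset_closedBall 0
  refine HasCompactSupport.intro (isCompact_closedBall (0 : Coord n) R) fun y hy => ?_
  refine indicator_eq_zero g i fun h1 => hy ?_
  have := hR h1
  rw [mem_closedBall_zero_iff, norm_foldCoord] at this
  rwa [mem_closedBall_zero_iff]

/-- Near a point of the chart target the function is a product of locally Lipschitz functions. At
any other point it vanishes nearby, since the compact support of `h` in the chart lies inside the
target. Folding is 1-Lipschitz and extends this across the boundary hyperplane. -/
lemma locallyLipschitz_localComp (hX : IsLipschitzField X)
    (hh : ContMDiff (𝓡∂ (n + 1)) 𝓘(ℝ, ℝ) 1 h) {p : Ω} (hp : tsupport h ⊆ (chart n p).source)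
    (i : Fin (n + 1)) : LocallyLipschitz (localComp g X h p i) := by
  have hK := isCompact_chartSupport (n := n) hp
  have h1 : LocallyLipschitzOn (range (𝓡∂ (n + 1))) ((chart n p).target.indicator
      (fun y => h ((chart n p).symm y) * densityField g X p y i)) := by
    have hin : LocallyLipschitzOn (chart n p).target
        (fun y => h ((chart n p).symm y) * densityField g X p y i) := by
      have e1 : LocallyLipschitzOn (chart n p).target (fun y => h ((chart n p).symm y)) := by
        intro y hy
        obtain ⟨K, t, ht, hl⟩ := (contDiffWithinAt_comp_symm hh hy).exists_lipschitzOnWith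
          convex_range_model
        exact ⟨K, t, nhdsWithin_mono _ (extChartAt_target_subset_range p) ht, hl⟩
      have e2 : LocallyLipschitzOn (chart n p).target (density g p) := by
        intro y hy
        have h3 := ((contDiffOn_density g p) y hy).of_le (m := 1) (by norm_cast)
        have h4 : ContDiffWithinAt ℝ 1 (density g p) (range (𝓡∂ (n + 1))) y :=
          h3.mono_of_mem_nhdsWithin (target_mem_nhdsWithin hy)
        obtain ⟨K, t, ht, hl⟩ := h4.exists_lipschitzOnWith convex_range_model
        exact ⟨K, t, nhdsWithin_mono _ (extChartAt_target_subset_range p) ht, hl⟩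
      have e3 : LocallyLipschitzOn (chart n p).target (fun y => chartField X p y i) :=
        locallyLipschitzOn_comp ((EuclideanSpace.proj i : Coord n →L[ℝ] ℝ).lipschitz
          |>.locallyLipschitz.locallyLipschitzOn (s := univ)) (hX p) (mapsTo_univ _ _)
      exact locallyLipschitzOn_mul e1 (locallyLipschitzOn_mul e2 e3)
    intro y hy
    by_cases ht : y ∈ (chart n p).target
    · obtain ⟨K, t, htn, hl⟩ := hin ht
      rw [nhdsWithin_extChartAt_target_eq_of_mem ht] at htn
      refine ⟨K, t ∩ (chart n p).target, Filter.inter_mem htn (target_mem_nhdsWithin ht), ?_⟩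
      intro a ha b hb
      rw [indicator_of_mem ha.2, indicator_of_mem hb.2]
      exact hl ha.1 hb.1
    · refine ⟨0, (chartSupport h p)ᶜ, mem_nhdsWithin_of_mem_nhds
        (hK.isClosed.isOpen_compl.mem_nhds fun h => ht (chartSupport_subset hp h)), ?_⟩
      intro a ha b hb
      rw [indicator_eq_zero g i ha, indicator_eq_zero g i hb]
      simp
  rw [← locallyLipschitzOn_univ]
  refine locallyLipschitzOn_comp h1
    (lipschitzWith_foldCoord.locallyLipschitz.locallyLipschitzOn) fun y _ => ?_
  rw [range_model]
  exact abs_nonneg (y 0)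

lemma lineDeriv_localComp_of_notMem {p : Ω} (hp : tsupport h ⊆ (chart n p).source)
    (i : Fin (n + 1)) {y : Coord n} (hy : y ∉ (chart n p).target) (h0 : 0 < y 0) (v : Coord n) :
    lineDeriv ℝ (localComp g X h p i) y v = 0 := by
  have hK := isCompact_chartSupport (n := n) hp
  have h1 : localComp g X h p i =ᶠ[𝓝 y] fun _ => 0 := by
    filter_upwards [hK.isClosed.isOpen_compl.mem_nhds fun h => hy (chartSupport_subset hp h),
      (isOpen_lt continuous_const (by fun_prop) : IsOpen {y : Coord n | 0 < y 0}).mem_nhds h0]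
      with z hz hz0
    rw [localComp, foldCoord_of_nonneg (le_of_lt hz0)]
    exact indicator_eq_zero g i hz
  rw [h1.lineDeriv_eq]
  simp [lineDeriv]

end Stokes

end RiemannianBoundary

namespace RiemannianBoundary

/-! ### The divergence theorem on the manifold -/

section Global

variable {n : ℕ} {Ω : Type*} [TopologicalSpace Ω] [ChartedSpace (EuclideanHalfSpace (n + 1)) Ω]
  [IsManifold (𝓡∂ (n + 1)) ∞ Ω] (g : Metric n Ω) {X : ∀ x : Ω, TangentSpace (𝓡∂ (n + 1)) x}
  {h : Ω → ℝ}

/-- The function `div (h X) = h div X + dh(X)`. -/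
def divMul (X : ∀ x : Ω, TangentSpace (𝓡∂ (n + 1)) x) (h : Ω → ℝ) (x : Ω) : ℝ :=
  h x * divergence g X x + differential h x (X x)

/-- The outward flux density `⟨h X, N⟩`. -/
def flux (X : ∀ x : Ω, TangentSpace (𝓡∂ (n + 1)) x) (h : Ω → ℝ) (x : Ω) : ℝ :=
  h x * g.inner x (X x) (outwardNormal g x)

lemma divMul_eq_zero {x : Ω} (hx : x ∉ tsupport h) : divMul g X h x = 0 := by
  have h1 : h =ᶠ[𝓝 x] fun _ => 0 := by
    filter_upwards [(isClosed_tsupport h).isOpen_compl.mem_nhds hx] with z hz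
    exact image_eq_zero_of_notMem_tsupport hz
  have h2 : differential h x (X x) = 0 := by
    change mfderiv (𝓡∂ (n + 1)) 𝓘(ℝ, ℝ) h x (X x) = 0
    rw [h1.mfderiv_eq, mfderiv_const]
    rfl
  rw [divMul, image_eq_zero_of_notMem_tsupport hx, h2, zero_mul, add_zero]

lemma flux_eq_zero {x : Ω} (hx : x ∉ tsupport h) : flux g X h x = 0 := by
  rw [flux, image_eq_zero_of_notMem_tsupport hx, zero_mul]

variable [MeasurableSpace Ω]

/-- `h X` has integrable divergence, integrable flux through the boundary, and satisfies the
divergence theorem. -/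
def DivergenceTheorem (X : ∀ x : Ω, TangentSpace (𝓡∂ (n + 1)) x) (h : Ω → ℝ) : Prop :=
  Integrable (divMul g X h) (volΩ g) ∧ Integrable (flux g X h) (volBdry g) ∧
    ∫ x, divMul g X h x ∂(volΩ g) = ∫ x, flux g X h x ∂(volBdry g)

/-- Both sides are additive in `h` once integrability is known; this is why the predicate includes
it, and what permits summation over a partition of unity. -/
lemma DivergenceTheorem.add {h k : Ω → ℝ} (hh : ContMDiff (𝓡∂ (n + 1)) 𝓘(ℝ, ℝ) 1 h)
    (hk : ContMDiff (𝓡∂ (n + 1)) 𝓘(ℝ, ℝ) 1 k) (h1 : DivergenceTheorem g X h)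
    (h2 : DivergenceTheorem g X k) : DivergenceTheorem g X (h + k) := by
  have e1 : divMul g X (h + k) = divMul g X h + divMul g X k := by
    funext x
    have h3 : differential (h + k) x (X x) = differential h x (X x) + differential k x (X x) := by
      have := mfderiv_add (hh.mdifferentiable (by simp) x) (hk.mdifferentiable (by simp) x)
      exact DFunLike.congr_fun this (X x)
    simp only [divMul, Pi.add_apply, h3]
    ring
  have e2 : flux g X (h + k) = flux g X h + flux g X k := by
    funext x
    simp only [flux, Pi.add_apply, add_mul]
  refine ⟨e1 ▸ h1.1.add h2.1, e2 ▸ h1.2.1.add h2.2.1, ?_⟩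
  rw [e1, e2, integral_add' h1.1 h2.1, integral_add' h1.2.1 h2.2.1, h1.2.2, h2.2.2]

lemma divergenceTheorem_zero : DivergenceTheorem g X 0 := by
  have e : ∀ x, x ∉ tsupport (0 : Ω → ℝ) := fun x => by
    rw [tsupport_eq_empty_iff.2 rfl]; exact notMem_empty x
  have e1 : divMul g X 0 = 0 := funext fun x => divMul_eq_zero g (e x)
  have e2 : flux g X 0 = 0 := funext fun x => flux_eq_zero g (e x)
  rw [DivergenceTheorem, e1, e2]
  exact ⟨integrable_zero _ _ _, integrable_zero _ _ _, by simp⟩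

variable [CompactSpace Ω] [BorelSpace Ω]

/-- At almost every parameter the integrand, times the density, is $\sum_i\partial_i(\sqrt{\det
g}\,hX^i)$. The half-space theorem leaves only the normal component on the boundary. -/
lemma chartVolume_divMul (hX : IsLipschitzField X) (hh : ContMDiff (𝓡∂ (n + 1)) 𝓘(ℝ, ℝ) 1 h)
    {p : Ω} (hp : tsupport h ⊆ (chart n p).source) :
    Integrable (divMul g X h) (chartVolume g p) ∧
      ∫ x, divMul g X h x ∂(chartVolume g p) = -∫ z, localComp g X h p 0 (face z) := by
  choose C hC using fun i => exists_lipschitzWith_of_hasCompactSupport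
    (locallyLipschitz_localComp g hX hh hp i) (hasCompactSupport_localComp g (X := X) hp i)
  have hint : ∀ i, Integrable fun y => lineDeriv ℝ (localComp g X h p i) y
      (EuclideanSpace.single i 1) := fun i =>
    integrable_lineDeriv_of_lipschitzWith (hC i) (hasCompactSupport_localComp g hp i) _
  have hm : MeasurableSet {y : Coord n | 0 < y 0} :=
    measurableSet_lt measurable_const (by fun_prop)
  obtain ⟨h1, h2⟩ := integral_map_withDensity (vol := volume) (measurableSet_target p)
    (continuousOn_extChartAt_symm p) (contDiffOn_density g p).continuousOn
    (fun y hy => density_pos g hy) (measurableSet_source p) (continuousOn_extChartAt p)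
    (fun y hy => (chart n p).map_target hy) (fun x hx => (chart n p).map_source hx)
    (fun y hy => (chart n p).right_inv hy) (fun x hx => (chart n p).left_inv hx)
    (k := divMul g X h)
    (G := fun y => ∑ i, lineDeriv ℝ (localComp g X h p i) y (EuclideanSpace.single i 1))
    (Finset.measurable_fun_sum _ fun i _ => measurable_lineDeriv (hC i).continuous)
    (by
      filter_upwards [ae_differentiableAt_of_locallyLipschitzOn volume (hX p), ae_zero_ne 0]
        with y hd hne hy
      have h0 : 0 < y 0 := lt_of_le_of_ne (target_subset p hy) hne.symm
      exact (sum_lineDeriv_localComp g hh hy h0 (hd (target_mem_nhds hy h0))).symm)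
    (integrable_finsetSum _ fun i _ => hint i).integrableOn
  refine ⟨h1, h2.trans ?_⟩
  have h3 : ((chart n p).target : Set (Coord n)) =ᵐ[volume]
      ((chart n p).target ∩ {y | 0 < y 0} : Set (Coord n)) := by
    filter_upwards [ae_zero_ne 0] with y hne
    refine propext ⟨fun hy => ⟨hy, ?_⟩, fun hy => hy.1⟩
    exact lt_of_le_of_ne (target_subset p hy) hne.symm
  -- The domain of integration becomes the whole open half space: the part of the target on the
  -- hyperplane is null, and off the target the derivatives vanish.
  rw [setIntegral_congr_set h3,
    ← setIntegral_eq_of_subset_of_forall_sdiff_eq_zero hm inter_subset_right (fun y hy =>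
      Finset.sum_eq_zero fun i _ => lineDeriv_localComp_of_notMem g hp i
        (fun h => hy.2 ⟨h, hy.1⟩) hy.1 _),
    integral_finsetSum _ fun i _ => (hint i).integrableOn]
  simp only [integral_lineDeriv_halfSpace (hC _) (hasCompactSupport_localComp g hp _)]
  simp

/-- By `boundaryDensity_mul_inner_outwardNormal` the flux is the same coordinate integral that comes
out of `chartVolume_divMul`. -/
lemma chartBoundaryVolume_flux (hX : IsLipschitzField X)
    (hh : ContMDiff (𝓡∂ (n + 1)) 𝓘(ℝ, ℝ) 1 h) {p : Ω} (hp : tsupport h ⊆ (chart n p).source) :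
    Integrable (flux g X h) (chartBoundaryVolume g p) ∧
      ∫ x, flux g X h x ∂(chartBoundaryVolume g p) = -∫ z, localComp g X h p 0 (face z) := by
  have hcont : Continuous fun z => localComp g X h p 0 (face z) :=
    (locallyLipschitz_localComp g hX hh hp 0).continuous.comp continuous_face
  have hemb : IsClosedEmbedding (face : EuclideanSpace ℝ (Fin n) → Coord n) :=
    Isometry.isClosedEmbedding (Isometry.of_dist_eq fun x y => by
      simp [EuclideanSpace.dist_eq, Fin.sum_univ_succ])
  have hcs : HasCompactSupport fun z => localComp g X h p 0 (face z) :=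
    (hasCompactSupport_localComp g (X := X) hp 0).comp_isClosedEmbedding hemb
  set U : Set Ω := (chart n p).source ∩ chart n p ⁻¹' {y | y 0 = 0} with hU
  have hUm : MeasurableSet U := measurableSet_inter_preimage (measurableSet_source p)
    (continuousOn_extChartAt p) (measurableSet_eq_fun (by fun_prop) measurable_const)
  have hface : ∀ x ∈ U, face (tailL n (chart n p x)) = chart n p x := fun x hx => face_tailL hx.2
  obtain ⟨h1, h2⟩ := integral_map_withDensity (vol := volume) (measurableSet_faceTarget p)
    (continuousOn_symm_face p) (continuousOn_boundaryDensity g p)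
    (fun z hz => boundaryDensity_pos g hz) (κ := fun x => tailL n (chart n p x)) hUm
    ((tailL n).continuous.comp_continuousOn ((continuousOn_extChartAt p).mono inter_subset_left))
    (fun z hz => ⟨(chart n p).map_target hz, by
      rw [mem_preimage, (chart n p).right_inv hz]; exact face_zero z⟩)
    (fun x hx => by rw [mem_preimage, hface x hx]; exact (chart n p).map_source hx.1)
    (fun z hz => by simp only [(chart n p).right_inv hz, tailL_face])
    (fun x hx => by simp only [hface x hx]; exact (chart n p).left_inv hx.1)
    (k := flux g X h) (G := fun z => -localComp g X h p 0 (face z)) hcont.measurable.neg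
    (ae_of_all _ fun z hz => by
      rw [localComp, foldCoord_of_nonneg (face_zero z).ge, indicator_of_mem (mem_preimage.1 hz),
        ← mul_neg,
        ← boundaryDensity_mul_inner_outwardNormal g X hz, flux]
      ring)
    (hcont.integrable_of_hasCompactSupport hcs).neg.integrableOn
  refine ⟨h1, h2.trans ?_⟩
  rw [setIntegral_eq_integral_of_forall_compl_eq_zero, integral_neg]
  intro z hz
  rw [localComp, foldCoord_of_nonneg (face_zero z).ge, indicator_of_notMem (mem_preimage.not.1 hz),
    neg_zero]

lemma divergenceTheorem_of_tsupport_subset (hX : IsLipschitzField X)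
    (hh : ContMDiff (𝓡∂ (n + 1)) 𝓘(ℝ, ℝ) 1 h) {p : Ω} (hp : tsupport h ⊆ (chart n p).source) :
    DivergenceTheorem g X h := by
  obtain ⟨h1, h2⟩ := chartVolume_divMul g hX hh hp
  obtain ⟨h3, h4⟩ := chartBoundaryVolume_flux g hX hh hp
  have e1 : ∀ x, x ∉ (chart n p).source → divMul g X h x = 0 := fun x hx =>
    divMul_eq_zero g fun h => hx (hp h)
  have e2 : ∀ x, x ∉ (chart n p).source → flux g X h x = 0 := fun x hx =>
    flux_eq_zero g fun h => hx (hp h)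
  rw [← volΩ_restrict_source] at h1 h2
  rw [← volBdry_restrict_source] at h3 h4
  refine ⟨(integrableOn_iff_integrable_of_support_subset fun x hx =>
    by_contra fun h => hx (e1 x h)).1 h1, (integrableOn_iff_integrable_of_support_subset fun x hx =>
    by_contra fun h => hx (e2 x h)).1 h3, ?_⟩
  rw [← setIntegral_eq_integral_of_forall_compl_eq_zero e1,
    ← setIntegral_eq_integral_of_forall_compl_eq_zero e2, h2, h4]

/-- The divergence theorem for `h X`, where `X` is a Lipschitz vector field and `h` is `C¹`. -/
theorem divergenceTheorem [T2Space Ω] (hX : IsLipschitzField X)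
    (hh : ContMDiff (𝓡∂ (n + 1)) 𝓘(ℝ, ℝ) 1 h) : DivergenceTheorem g X h := by
  classical
  -- By compactness finitely many charts suffice, so `h` is a finite sum of functions each supported
  -- in one chart domain.
  obtain ⟨t, ht⟩ := isCompact_univ.elim_nhds_subcover (fun p : Ω => (chart n p).source)
    fun p _ => extChartAt_source_mem_nhds p
  obtain ⟨ρ, hρ⟩ := SmoothPartitionOfUnity.exists_isSubordinate (𝓡∂ (n + 1)) isClosed_univ
    (fun p : t => (chart n (p : Ω)).source) (fun p => isOpen_extChartAt_source (p : Ω))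
    (fun x hx => by
      obtain ⟨p, hp, hxp⟩ := mem_iUnion₂.1 (ht.2 hx)
      exact mem_iUnion.2 ⟨⟨p, hp⟩, hxp⟩)
  have hρs : ∀ p : t, ContMDiff (𝓡∂ (n + 1)) 𝓘(ℝ, ℝ) 1 fun x => ρ p x * h x := fun p =>
    ((ρ p).contMDiff.of_le (by norm_cast)).mul hh
  have hsum : h = ∑ p : t, fun x => ρ p x * h x := by
    funext x
    rw [Finset.sum_apply, ← Finset.sum_mul, ← finsum_eq_sum_of_fintype, ρ.sum_eq_one (mem_univ x),
      one_mul]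
  rw [hsum]
  refine (Finset.sum_induction (fun p : t => fun x => ρ p x * h x)
    (fun k => ContMDiff (𝓡∂ (n + 1)) 𝓘(ℝ, ℝ) 1 k ∧ DivergenceTheorem g X k)
    (fun k l hk hl => ⟨hk.1.add hl.1, hk.2.add g hk.1 hl.1 hl.2⟩) ?_ fun p _ => ⟨hρs p, ?_⟩).2
  · exact ⟨contMDiff_const, divergenceTheorem_zero g⟩
  · refine divergenceTheorem_of_tsupport_subset g hX (hρs p) (p := p) ?_
    exact (tsupport_mul_subset_left (f := ρ p) (g := h)).trans (hρ p)

end Global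

end RiemannianBoundary

namespace RiemannianBoundary

section Energy

variable {n : ℕ} {Ω : Type*} [TopologicalSpace Ω] [ChartedSpace (EuclideanHalfSpace (n + 1)) Ω]
  [IsManifold (𝓡∂ (n + 1)) ∞ Ω] (g : Metric n Ω) {f : Ω → ℝ}

/-! ### Gradients of `C¹` functions -/

lemma normSq_nonneg (x : Ω) (v : TangentSpace (𝓡∂ (n + 1)) x) : 0 ≤ normSq g x v := by
  by_cases hv : v = 0
  · rw [hv, normSq, map_zero]
  · exact (g.pos x v hv).le

/-- The quadratic polynomial $t\mapsto|v+tw|^2$ is nonnegative, so its discriminant is nonpositive.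
-/
lemma sq_inner_le (x : Ω) (v w : TangentSpace (𝓡∂ (n + 1)) x) :
    g.inner x v w ^ 2 ≤ normSq g x v * normSq g x w := by
  have h : ∀ t : ℝ, 0 ≤ normSq g x w * (t * t) + 2 * g.inner x v w * t + normSq g x v := fun t => by
    have h1 := normSq_nonneg g x (v + t • w)
    have h2 := g.symm x w v
    simp only [normSq, map_add, map_smul, add_apply, smul_apply, smul_eq_mul] at h1 ⊢
    rw [h2] at h1
    linarith
  have := discrim_le_zero h
  rw [discrim] at this
  linarith

lemma normSq_grad (f : Ω → ℝ) (x : Ω) :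
    normSq g x (grad g f x) = differential f x (grad g f x) := inner_sharp g x _ _

lemma inner_grad (f : Ω → ℝ) (x : Ω) (v : TangentSpace (𝓡∂ (n + 1)) x) :
    g.inner x (grad g f x) v = differential f x v := inner_sharp g x _ _

lemma abs_differential_grad_le (f φ : Ω → ℝ) (x : Ω) :
    |differential f x (grad g φ x)| ≤
      √(normSq g x (grad g f x)) * √(normSq g x (grad g φ x)) := by
  rw [← inner_grad g, ← Real.sqrt_mul (normSq_nonneg g x _)]
  exact Real.abs_le_sqrt (sq_inner_le g x _ _)

/-- The partial derivatives of `f` in the chart around `p`. -/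
def partials (f : Ω → ℝ) (p : Ω) (y : Coord n) (i : Fin (n + 1)) : ℝ :=
  fderivWithin ℝ (fun y => f ((chart n p).symm y)) (chart n p).target y (EuclideanSpace.single i 1)

lemma fderivWithin_target (hf : ContMDiff (𝓡∂ (n + 1)) 𝓘(ℝ, ℝ) 1 f) {p : Ω} {y : Coord n}
    (hy : y ∈ (chart n p).target) :
    fderivWithin ℝ (fun y => f ((chart n p).symm y)) (chart n p).target y =
      dFun n f ((chart n p).symm y) ∘L dParam n p y :=
  ((hasFDerivWithinAt_comp_symm hf hy).mono (extChartAt_target_subset_range p)).fderivWithin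
    (uniqueDiffOn_extChartAt_target p y hy)

lemma contDiffOn_comp_symm (hf : ContMDiff (𝓡∂ (n + 1)) 𝓘(ℝ, ℝ) 1 f) (p : Ω) :
    ContDiffOn ℝ 1 (fun y => f ((chart n p).symm y)) (chart n p).target := fun _ hy =>
  (contDiffWithinAt_comp_symm hf hy).mono (extChartAt_target_subset_range p)

lemma continuousOn_partials (hf : ContMDiff (𝓡∂ (n + 1)) 𝓘(ℝ, ℝ) 1 f) (p : Ω) :
    ContinuousOn (partials f p) (chart n p).target :=
  continuousOn_pi.2 fun _ => ((contDiffOn_comp_symm hf p).continuousOn_fderivWithin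
    (uniqueDiffOn_extChartAt_target p) le_rfl).clm_apply continuousOn_const

lemma differential_dParam (hf : ContMDiff (𝓡∂ (n + 1)) 𝓘(ℝ, ℝ) 1 f) {p : Ω} {y : Coord n}
    (hy : y ∈ (chart n p).target) (w : Coord n) :
    differential f ((chart n p).symm y) (dParam n p y w) =
      partials f p y ⬝ᵥ (w : Fin (n + 1) → ℝ) := by
  have h1 : differential f ((chart n p).symm y) (dParam n p y w) =
      (dFun n f ((chart n p).symm y) ∘L dParam n p y) w := rfl
  rw [h1, ← fderivWithin_target hf hy]
  conv_lhs => rw [coord_eq_sum w]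
  simp [dotProduct, partials, mul_comm]

/-- This is $|\nabla f|^2=g^{ij}\partial_if\,\partial_jf$, with the inverse matrix written as
adjugate over determinant so that continuity in `y` can be read off. -/
lemma normSq_grad_symm (hf : ContMDiff (𝓡∂ (n + 1)) 𝓘(ℝ, ℝ) 1 f) {p : Ω} {y : Coord n}
    (hy : y ∈ (chart n p).target) :
    normSq g _ (grad g f ((chart n p).symm y)) = (gram g p y).det⁻¹ *
      (partials f p y ⬝ᵥ (gram g p y).adjugate.mulVec (partials f p y)) := by
  have h1 := gram_mulVec_chart_sharp g hy (differential f ((chart n p).symm y))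
    (differential_dParam hf hy)
  set s := dChart n p ((chart n p).symm y)
    (sharp g ((chart n p).symm y) (differential f ((chart n p).symm y))) with hs
  have h2 : dParam n p y s = grad g f ((chart n p).symm y) := dParam_dChart hy _
  have hd := (posDef_gram g hy).det_pos
  rw [normSq_grad, ← h2, differential_dParam hf hy]
  conv_rhs => rw [← h1]
  rw [Matrix.mulVec_mulVec, Matrix.adjugate_mul, Matrix.smul_mulVec, Matrix.one_mulVec,
    dotProduct_smul, smul_eq_mul, h1, inv_mul_cancel_left₀ hd.ne']

lemma continuousOn_gram (p : Ω) : ContinuousOn (gram g p) (chart n p).target :=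
  continuousOn_pi.2 fun i => continuousOn_pi.2 fun j => (contDiffOn_gram g p i j).continuousOn

lemma continuous_normSq_grad (hf : ContMDiff (𝓡∂ (n + 1)) 𝓘(ℝ, ℝ) 1 f) :
    Continuous fun x => normSq g x (grad g f x) := by
  rw [continuous_iff_continuousAt]
  intro p
  have h1 : ContinuousOn (fun y => (gram g p y).det⁻¹ *
      (partials f p y ⬝ᵥ (gram g p y).adjugate.mulVec (partials f p y))) (chart n p).target := by
    have h2 := continuousOn_gram g p
    have h3 := continuousOn_partials hf p
    have h4 : ContinuousOn (fun y => (gram g p y).det) (chart n p).target :=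
      (continuous_id.matrix_det).comp_continuousOn h2
    have h5 : ContinuousOn (fun y => (gram g p y).adjugate) (chart n p).target :=
      (continuous_id.matrix_adjugate).comp_continuousOn h2
    have h6 : Continuous fun q : (Fin (n + 1) → ℝ) × Matrix (Fin (n + 1)) (Fin (n + 1)) ℝ =>
        q.1 ⬝ᵥ q.2.mulVec q.1 := continuous_fst.dotProduct (continuous_snd.matrix_mulVec continuous_fst)
    exact (h4.inv₀ fun y hy => (posDef_gram g hy).det_pos.ne').mul
      (h6.comp_continuousOn (h3.prodMk h5))
  have h2 := h1.comp (continuousOn_extChartAt p) fun x hx => (chart n p).map_source hx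
  refine (h2.congr fun x hx => ?_).continuousAt (extChartAt_source_mem_nhds p)
  rw [Function.comp_apply, ← normSq_grad_symm g hf ((chart n p).map_source hx)]
  rw [(chart n p).left_inv hx]

/-- In a chart a small ball intersected with the half space is convex, and the mean value inequality
applies there with constant 0, also at boundary points. -/
lemma isLocallyConstant_of_grad_eq_zero (hf : ContMDiff (𝓡∂ (n + 1)) 𝓘(ℝ, ℝ) 1 f)
    (h0 : ∀ x, normSq g x (grad g f x) = 0) : IsLocallyConstant f := by
  have hd : ∀ x, dFun n f x = 0 := fun x => by
    have h1 : grad g f x = 0 := by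
      by_contra h
      exact (g.pos x _ h).ne' (h0 x)
    ext1 v
    have h2 := inner_grad g f x v
    rw [h1, map_zero] at h2
    exact h2.symm
  rw [IsLocallyConstant.iff_eventually_eq]
  intro p
  obtain ⟨r, hr, hball⟩ := Metric.mem_nhdsWithin_iff.1
    (target_mem_nhdsWithin (mem_extChartAt_target (I := 𝓡∂ (n + 1)) p))
  set S := Metric.ball (chart n p p) r ∩ range (𝓡∂ (n + 1)) with hS
  have hconv : Convex ℝ S := (convex_ball _ _).inter convex_range_model
  have hder : ∀ y ∈ S, HasFDerivWithinAt (fun y => f ((chart n p).symm y)) 0 S y := fun y hy => by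
    have h1 := hasFDerivWithinAt_comp_symm hf (hball hy)
    rw [hd, ContinuousLinearMap.zero_comp] at h1
    exact h1.mono inter_subset_right
  have hconst : ∀ y ∈ S, f ((chart n p).symm y) = f p := fun y hy => by
    have h1 := hconv.norm_image_sub_le_of_norm_hasFDerivWithin_le (C := 0) hder (by simp)
      (⟨Metric.mem_ball_self hr, mem_range_self _⟩ : chart n p p ∈ S) hy
    rw [zero_mul, extChartAt_to_inv] at h1
    exact sub_eq_zero.1 (norm_le_zero_iff.1 h1)
  have hnhds : (chart n p).source ∩ chart n p ⁻¹' Metric.ball (chart n p p) r ∈ 𝓝 p :=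
    Filter.inter_mem (extChartAt_source_mem_nhds p)
      (continuousAt_extChartAt p (Metric.ball_mem_nhds _ hr))
  filter_upwards [hnhds] with x hx
  rw [← hconst (chart n p x) ⟨hx.2, extChartAt_target_subset_range p ((chart n p).map_source hx.1)⟩,
    (chart n p).left_inv hx.1]

end Energy

/-! ### The Cauchy–Schwarz inequality -/

/-- Hölder's inequality with exponents 2 and 2 for integrals in $[0,\infty]$. Neither `u` nor `v`
has to be square integrable, so the case $|\Delta\varphi|_2=\infty$ needs no separate treatment. -/
lemma ofReal_sq_integral_le {α : Type*} [MeasurableSpace α] {μ : Measure α} {k u v : α → ℝ}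
    (hu : AEMeasurable u μ) (hv : AEMeasurable v μ) (h : ∀ x, |k x| ≤ |u x| * |v x|) :
    ENNReal.ofReal ((∫ x, k x ∂μ) ^ 2) ≤
      (∫⁻ x, ENNReal.ofReal (u x ^ 2) ∂μ) * ∫⁻ x, ENNReal.ofReal (v x ^ 2) ∂μ := by
  have e : ∀ r : ℝ, ENNReal.ofReal (r ^ 2) = ‖r‖ₑ ^ (2 : ℝ) := fun r => by
    rw [← sq_abs, ENNReal.ofReal_pow (abs_nonneg r), ← Real.enorm_eq_ofReal_abs,
      ENNReal.rpow_ofNat]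
  have h1 : ‖∫ x, k x ∂μ‖ₑ ≤ ∫⁻ x, ((fun x => ‖u x‖ₑ) * fun x => ‖v x‖ₑ) x ∂μ := by
    refine (enorm_integral_le_lintegral_enorm k).trans (lintegral_mono fun x => ?_)
    simp only [Pi.mul_apply, Real.enorm_eq_ofReal_abs, ← ENNReal.ofReal_mul (abs_nonneg _)]
    exact ENNReal.ofReal_le_ofReal (h x)
  have h2 := h1.trans (ENNReal.lintegral_mul_le_Lp_mul_Lq μ Real.HolderConjugate.two_two
    hu.enorm hv.enorm)
  simp only [e]
  calc ‖∫ x, k x ∂μ‖ₑ ^ (2 : ℝ) ≤ _ := ENNReal.rpow_le_rpow h2 (by norm_num)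
    _ = _ := by
      rw [ENNReal.mul_rpow_of_nonneg _ _ (by norm_num), ← ENNReal.rpow_mul, ← ENNReal.rpow_mul]
      norm_num

end RiemannianBoundary

namespace RiemannianBoundary

section Mean

variable {n : ℕ} {Ω : Type*} [TopologicalSpace Ω] [ChartedSpace (EuclideanHalfSpace (n + 1)) Ω]
  [IsManifold (𝓡∂ (n + 1)) ∞ Ω] (g : Metric n Ω) [MeasurableSpace Ω] {f φ : Ω → ℝ}

/-! ### The normalised measures -/

lemma integral_lamΩ (k : Ω → ℝ) :
    ∫ x, k x ∂(lamΩ g) = (volΩ g univ).toReal⁻¹ * ∫ x, k x ∂(volΩ g) := by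
  rw [lamΩ, integral_smul_measure, ENNReal.toReal_inv, smul_eq_mul]

lemma integral_lamBdry (k : Ω → ℝ) :
    ∫ x, k x ∂(lamBdry g) = (volBdry g univ).toReal⁻¹ * ∫ x, k x ∂(volBdry g) := by
  rw [lamBdry, integral_smul_measure, ENNReal.toReal_inv, smul_eq_mul]

variable [BorelSpace Ω]

lemma integrable_lamΩ [Nonempty Ω] {k : Ω → ℝ} (hk : Integrable k (volΩ g)) :
    Integrable k (lamΩ g) :=
  hk.smul_measure (ENNReal.inv_ne_top.2 (volΩ_ne_zero_of_isOpen g isOpen_univ univ_nonempty))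

/-- Every boundary parametrization takes its values in the boundary. Needed because the normal
derivative of `φ` is prescribed only there. -/
lemma volBdry_eq_restrict_boundary :
    volBdry g = (volBdry g).restrict ((𝓡∂ (n + 1)).boundary Ω) := by
  have hB : MeasurableSet ((𝓡∂ (n + 1)).boundary Ω) :=
    ((𝓡∂ (n + 1)).isClosed_boundary (n := 1) one_ne_zero).measurableSet
  refine le_antisymm (iSup_le fun p => ?_) Measure.restrict_le_self
  have h1 : chartBoundaryVolume g p = (chartBoundaryVolume g p).restrict
      ((𝓡∂ (n + 1)).boundary Ω) := by
    refine (Measure.restrict_eq_self_of_ae_mem ?_).symm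
    refine (ae_map_iff (aemeasurable_param (measurableSet_faceTarget p)
      (continuousOn_symm_face p) _) hB).2 ?_
    refine (withDensity_absolutelyContinuous _ _).ae_le ?_
    refine (ae_restrict_iff' (measurableSet_faceTarget p)).2 (ae_of_all _ fun z hz => ?_)
    exact (isBoundaryPoint_symm_iff hz).2 (face_zero z)
  rw [h1]
  exact Measure.restrict_mono subset_rfl (le_iSup (chartBoundaryVolume g) p)

lemma ofReal_sq_integral_grad_le (hf : ContMDiff (𝓡∂ (n + 1)) 𝓘(ℝ, ℝ) 1 f)
    (hφ : ContMDiff (𝓡∂ (n + 1)) 𝓘(ℝ, ℝ) 1 φ) :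
    ENNReal.ofReal ((∫ x, differential f x (grad g φ x) ∂(lamΩ g)) ^ 2) ≤
      energyΩ g f * energyΩ g φ := by
  have h := ofReal_sq_integral_le (μ := lamΩ g) (k := fun x => differential f x (grad g φ x))
    (u := fun x => √(normSq g x (grad g f x))) (v := fun x => √(normSq g x (grad g φ x)))
    (continuous_normSq_grad g hf).sqrt.aemeasurable (continuous_normSq_grad g hφ).sqrt.aemeasurable
    fun x => by
      rw [abs_of_nonneg (Real.sqrt_nonneg _), abs_of_nonneg (Real.sqrt_nonneg _)]
      exact abs_differential_grad_le g f φ x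
  simp only [Real.sq_sqrt (normSq_nonneg g _ _)] at h
  exact h

lemma integral_flux_grad {σ : ℝ} (hσ : ∀ x ∈ (𝓡∂ (n + 1)).boundary Ω, normalDeriv g φ x = σ)
    (h : Ω → ℝ) : ∫ x, flux g (grad g φ) h x ∂(volBdry g) = σ * ∫ x, h x ∂(volBdry g) := by
  have hB : MeasurableSet ((𝓡∂ (n + 1)).boundary Ω) :=
    ((𝓡∂ (n + 1)).isClosed_boundary (n := 1) one_ne_zero).measurableSet
  rw [volBdry_eq_restrict_boundary, ← integral_const_mul]
  refine setIntegral_congr_fun hB fun x hx => ?_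
  simp only [flux, inner_grad]
  rw [← normalDeriv, hσ x hx, mul_comm]

variable [CompactSpace Ω]

lemma isProbabilityMeasure_lamΩ [Nonempty Ω] : IsProbabilityMeasure (lamΩ g) :=
  ⟨by rw [lamΩ, Measure.smul_apply, smul_eq_mul, ENNReal.inv_mul_cancel
    (volΩ_ne_zero_of_isOpen g isOpen_univ univ_nonempty) (volΩ_univ_lt_top g).ne]⟩

lemma isProbabilityMeasure_lamBdry (h : ((𝓡∂ (n + 1)).boundary Ω).Nonempty) :
    IsProbabilityMeasure (lamBdry g) :=
  ⟨by rw [lamBdry, Measure.smul_apply, smul_eq_mul, ENNReal.inv_mul_cancel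
    (volBdry_univ_pos g h) (volBdry_univ_lt_top g).ne]⟩

/-- Green's formula for a `C¹` function and a function with Lipschitz gradient and constant normal
derivative. -/
lemma green [T2Space Ω] (hφL : IsLipschitzField (grad g φ)) {σ : ℝ}
    (hσ : ∀ x ∈ (𝓡∂ (n + 1)).boundary Ω, normalDeriv g φ x = σ)
    (hf : ContMDiff (𝓡∂ (n + 1)) 𝓘(ℝ, ℝ) 1 f) :
    Integrable (laplacian g φ) (volΩ g) ∧
    Integrable (fun x => f x * laplacian g φ x) (volΩ g) ∧
    Integrable (fun x => differential f x (grad g φ x)) (volΩ g) ∧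
    ∫ x, f x * laplacian g φ x ∂(volΩ g) + ∫ x, differential f x (grad g φ x) ∂(volΩ g) =
      σ * ∫ x, f x ∂(volBdry g) := by
  have h1 : Integrable (laplacian g φ) (volΩ g) := by
    -- With the constant function 1 the divergence of the field is the Laplacian itself, so the
    -- theorem supplies its integrability.
    have h := (divergenceTheorem g hφL (h := fun _ => 1) contMDiff_const).1
    refine h.congr (ae_of_all _ fun x => ?_)
    have h2 : differential (fun _ : Ω => (1 : ℝ)) x (grad g φ x) = 0 := by
      change mfderiv (𝓡∂ (n + 1)) 𝓘(ℝ, ℝ) (fun _ : Ω => (1 : ℝ)) x (grad g φ x) = 0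
      rw [mfderiv_const]
      rfl
    simp only [divMul, h2, laplacian]
    ring
  obtain ⟨M, hM⟩ := isCompact_univ.exists_bound_of_continuousOn hf.continuous.continuousOn
  have h2 : Integrable (fun x => f x * laplacian g φ x) (volΩ g) :=
    h1.bdd_mul hf.continuous.aestronglyMeasurable (ae_of_all _ fun x => hM x (mem_univ x))
  obtain ⟨h3, -, h4⟩ := divergenceTheorem g hφL hf
  have h5 : Integrable (fun x => differential f x (grad g φ x)) (volΩ g) := by
    refine (h3.sub h2).congr (ae_of_all _ fun x => ?_)
    simp [divMul, laplacian]
  refine ⟨h1, h2, h5, ?_⟩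
  rw [← integral_add h2 h5, ← integral_flux_grad g hσ, ← h4]
  rfl

lemma integrable_of_continuous {μ : Measure Ω} [IsFiniteMeasure μ] {k : Ω → ℝ}
    (hk : Continuous k) : Integrable k μ :=
  hk.integrable_of_hasCompactSupport (HasCompactSupport.of_compactSpace k)

lemma energyΩ_ne_top [Nonempty Ω] (hf : ContMDiff (𝓡∂ (n + 1)) 𝓘(ℝ, ℝ) 1 f) :
    energyΩ g f ≠ ⊤ := by
  have := isProbabilityMeasure_lamΩ g
  have h := integrable_of_continuous (μ := lamΩ g) (continuous_normSq_grad g hf)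
  exact h.lintegral_lt_top.ne

lemma Var_eq (μ : Measure Ω) [IsProbabilityMeasure μ] (hf : Continuous f) :
    Var μ f = ∫ x, (f x - ∫ y, f y ∂μ) ^ 2 ∂μ := by
  set m := ∫ y, f y ∂μ with hm
  have h1 : (fun x => (f x - m) ^ 2) = fun x => (f x ^ 2 - 2 * m * f x) + m ^ 2 := by
    funext x; ring
  have i1 : Integrable (fun x => f x ^ 2) μ := integrable_of_continuous (hf.pow 2)
  have i2 : Integrable (fun x => 2 * m * f x) μ := integrable_of_continuous (by fun_prop)
  have i3 : Integrable (fun x => f x ^ 2 - 2 * m * f x) μ := i1.sub i2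
  rw [h1, integral_add i3 (integrable_const _), integral_sub i1 i2, integral_const_mul,
    integral_const, ← hm, Var, ← hm]
  simp
  ring

lemma ofReal_Var_eq (μ : Measure Ω) [IsProbabilityMeasure μ] (hf : Continuous f) :
    ENNReal.ofReal (Var μ f) = ∫⁻ x, ENNReal.ofReal ((f x - ∫ y, f y ∂μ) ^ 2) ∂μ := by
  rw [Var_eq μ hf, ofReal_integral_eq_lintegral_ofReal
    (integrable_of_continuous (by fun_prop)) (ae_of_all _ fun x => sq_nonneg _)]

/-- A continuous function vanishing almost everywhere vanishes everywhere, because nonempty open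
sets have positive volume. Hence the gradient is zero and `f` is constant by connectedness. -/
lemma Var_eq_zero_of_energyΩ_eq_zero [ConnectedSpace Ω]
    (hf : ContMDiff (𝓡∂ (n + 1)) 𝓘(ℝ, ℝ) 1 f) (h : energyΩ g f = 0) : Var (lamΩ g) f = 0 := by
  have := isProbabilityMeasure_lamΩ g
  have hc := continuous_normSq_grad g hf
  have hV : (volΩ g univ)⁻¹ ≠ 0 := ENNReal.inv_ne_zero.2 (volΩ_univ_lt_top g).ne
  rw [energyΩ, lamΩ, lintegral_smul_measure, smul_eq_mul, mul_eq_zero, or_iff_right hV,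
    lintegral_eq_zero_iff hc.measurable.ennreal_ofReal] at h
  have h0 : ∀ x, normSq g x (grad g f x) = 0 := by
    by_contra! hne
    refine volΩ_ne_zero_of_isOpen g (hc.isOpen_preimage _ isOpen_ne : IsOpen _) hne ?_
    refine measure_eq_zero_iff_ae_notMem.2 ?_
    filter_upwards [h] with x hx hx'
    simp only [Pi.zero_apply, ENNReal.ofReal_eq_zero] at hx
    exact hx' (le_antisymm hx (normSq_nonneg g x _))
  have hconst := isLocallyConstant_of_grad_eq_zero g hf h0
  obtain ⟨p⟩ : Nonempty Ω := inferInstance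
  have : f = fun _ => f p := funext fun x => hconst.apply_eq_of_preconnectedSpace x p
  rw [this, Var]
  simp

/-- The Poincaré inequality with the constant `poincareConst`. -/
lemma ofReal_Var_le [ConnectedSpace Ω] (hf : ContMDiff (𝓡∂ (n + 1)) 𝓘(ℝ, ℝ) 1 f) :
    ENNReal.ofReal (Var (lamΩ g) f) ≤ poincareConst g * energyΩ g f := by
  -- The infimum is reached by dividing by the energy, which must be positive and finite. With zero
  -- energy the right side is 0 even for an infinite constant, so the variance itself must vanish.
  by_cases h : energyΩ g f = 0
  · simp [Var_eq_zero_of_energyΩ_eq_zero g hf h]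
  · have h' := energyΩ_ne_top g hf
    rw [← ENNReal.div_le_iff h h']
    refine le_sInf fun C hC => ?_
    rw [ENNReal.div_le_iff h h']
    exact hC f hf

/-- Young's inequality $2ab\le\varepsilon a^2+\varepsilon^{-1}b^2$, from
$\varepsilon^{-1}(\varepsilon a-b)^2\ge0$. -/
lemma ofReal_add_sq_le (a b : ℝ) {ε : ℝ} (hε : 0 < ε) :
    ENNReal.ofReal ((a + b) ^ 2) ≤ ENNReal.ofReal (1 + ε) * ENNReal.ofReal (a ^ 2) +
      ENNReal.ofReal (1 + ε⁻¹) * ENNReal.ofReal (b ^ 2) := by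
  rw [← ENNReal.ofReal_mul (by positivity), ← ENNReal.ofReal_mul (by positivity),
    ← ENNReal.ofReal_add (by positivity) (by positivity)]
  refine ENNReal.ofReal_le_ofReal ?_
  have h : 0 ≤ ε⁻¹ * (ε * a - b) ^ 2 := by positivity
  have h2 : ε⁻¹ * (ε * a - b) ^ 2 = ε * a ^ 2 - 2 * a * b + ε⁻¹ * b ^ 2 := by
    field_simp
    ring
  linarith

/-- The difference of the means of `f` over `Ω` and `∂Ω`, from Green's formula. -/
lemma sq_sub_mean_eq [T2Space Ω] [Nonempty Ω] (hne : ((𝓡∂ (n + 1)).boundary Ω).Nonempty)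
    (hφL : IsLipschitzField (grad g φ)) {σ : ℝ} (hσ1 : σ ^ 2 = 1)
    (hσ : ∀ x ∈ (𝓡∂ (n + 1)).boundary Ω, normalDeriv g φ x = σ)
    (hf : ContMDiff (𝓡∂ (n + 1)) 𝓘(ℝ, ℝ) 1 f) :
    (∫ x, f x ∂(lamΩ g) - ∫ x, f x ∂(lamBdry g)) ^ 2 =
      ((volΩ g univ).toReal / (volBdry g univ).toReal) ^ 2 *
        (∫ x, differential f x (grad g φ x) ∂(lamΩ g) +
          ∫ x, (f x - ∫ y, f y ∂(lamΩ g)) * laplacian g φ x ∂(lamΩ g)) ^ 2 := by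
  have hP := isProbabilityMeasure_lamBdry g hne
  set m := ∫ x, f x ∂(lamΩ g) with hm
  -- Green's formula is applied to `f - m`: the gradient is unchanged, the boundary mean becomes the
  -- difference of means, and the Laplacian is paired with a function whose squared norm is the
  -- variance.
  have hk : ContMDiff (𝓡∂ (n + 1)) 𝓘(ℝ, ℝ) 1 fun x => f x - m := hf.sub contMDiff_const
  obtain ⟨-, -, -, h⟩ := green g hφL hσ hk
  have hd : ∀ x, differential (fun x => f x - m) x (grad g φ x) =
      differential f x (grad g φ x) := fun x => by
    have h1 := mfderiv_sub (hf.mdifferentiable one_ne_zero x)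
      (mdifferentiableAt_const (I := 𝓡∂ (n + 1)) (I' := 𝓘(ℝ, ℝ)) (c := m))
    rw [mfderiv_const] at h1
    exact (DFunLike.congr_fun h1 (grad g φ x)).trans (sub_zero (differential f x (grad g φ x)))
  have hb : ∫ x, (f x - m) ∂(lamBdry g) = ∫ x, f x ∂(lamBdry g) - m := by
    rw [integral_sub (integrable_of_continuous hf.continuous) (integrable_const _), integral_const]
    simp
  have hV : (volΩ g univ).toReal ≠ 0 := ENNReal.toReal_ne_zero.2
    ⟨volΩ_ne_zero_of_isOpen g isOpen_univ univ_nonempty, (volΩ_univ_lt_top g).ne⟩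
  have hB : (volBdry g univ).toReal ≠ 0 := ENNReal.toReal_ne_zero.2
    ⟨volBdry_univ_pos g hne, (volBdry_univ_lt_top g).ne⟩
  simp only [hd] at h
  rw [← neg_sub, neg_sq, ← hb, integral_lamBdry, integral_lamΩ g (fun x => (differential f x) _),
    integral_lamΩ g (fun x => (f x - m) * _), ← mul_add, add_comm (∫ x, (differential f x) _ ∂_), h]
  field_simp
  rw [hσ1, mul_one]

end Mean

end RiemannianBoundary

end

/-! ### The inequality between the two means -/

open RiemannianBoundary in
theorem mainTheorem9 {n : ℕ} (hn : 2 ≤ n + 1)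
    {Ω : Type*} [TopologicalSpace Ω] [T2Space Ω] [CompactSpace Ω] [ConnectedSpace Ω]
    [MeasurableSpace Ω] [BorelSpace Ω]
    [ChartedSpace (EuclideanHalfSpace (n + 1)) Ω] [IsManifold (𝓡∂ (n + 1)) ∞ Ω]
    (hbdry : IsConnected ((𝓡∂ (n + 1)).boundary Ω))
    (g : Metric n Ω)
    (φ : Ω → ℝ) (hφ : ContMDiff (𝓡∂ (n + 1)) 𝓘(ℝ, ℝ) 1 φ)
    (hφN : (∀ x ∈ (𝓡∂ (n + 1)).boundary Ω, normalDeriv g φ x = 1) ∨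
      (∀ x ∈ (𝓡∂ (n + 1)).boundary Ω, normalDeriv g φ x = -1))
    (hφL : IsLipschitzField (grad g φ)) :
    MixedMeanInequality g
      ((volΩ g univ / volBdry g univ) ^ 2 *
        ⨅ ε ∈ Ioi (0 : ℝ), (ENNReal.ofReal (1 + ε) * energyΩ g φ +
          ENNReal.ofReal (1 + ε⁻¹) * poincareConst g * laplacianSq g φ))
      0 := by
  intro f hf
  have hP := isProbabilityMeasure_lamΩ g
  rw [zero_mul, add_zero]
  -- Both signs are treated at once, since only the square of the normal derivative enters.
  obtain ⟨σ, hσ1, hσ⟩ : ∃ σ : ℝ, σ ^ 2 = 1 ∧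
      ∀ x ∈ (𝓡∂ (n + 1)).boundary Ω, normalDeriv g φ x = σ :=
    hφN.elim (fun h => ⟨1, by norm_num, h⟩) (fun h => ⟨-1, by norm_num, h⟩)
  have hV0 := volΩ_ne_zero_of_isOpen g isOpen_univ univ_nonempty
  have hVt := (volΩ_univ_lt_top g).ne
  have hB0 := volBdry_univ_pos g hbdry.nonempty
  have hBt := (volBdry_univ_lt_top g).ne
  have hE := energyΩ_ne_top g hf
  obtain ⟨hΔ, -, -, -⟩ := green g hφL hσ hf
  have hΔm : AEMeasurable (laplacian g φ) (lamΩ g) := (integrable_lamΩ g hΔ).aemeasurable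
  set K := (volΩ g univ / volBdry g univ) ^ 2 with hK
  have hK0 : K ≠ 0 := pow_ne_zero _ (ENNReal.div_ne_zero.2 ⟨hV0, hBt⟩)
  have hKt : K ≠ ⊤ := ENNReal.pow_ne_top (ENNReal.div_ne_top hVt hB0)
  have ha := ofReal_sq_integral_grad_le g hf hφ
  have hb : ENNReal.ofReal ((∫ x, (f x - ∫ y, f y ∂(lamΩ g)) * laplacian g φ x ∂(lamΩ g)) ^ 2) ≤
      poincareConst g * energyΩ g f * laplacianSq g φ := by
    refine (ofReal_sq_integral_le (u := fun x => f x - ∫ y, f y ∂(lamΩ g))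
      (v := laplacian g φ) (hf.continuous.sub continuous_const).aemeasurable hΔm
      fun x => (abs_mul _ _).le).trans ?_
    rw [← ofReal_Var_eq _ hf.continuous]
    exact mul_le_mul_left (ofReal_Var_le g hf) _
  have key : ∀ ε ∈ Ioi (0 : ℝ),
      ENNReal.ofReal ((∫ x, f x ∂(lamΩ g) - ∫ x, f x ∂(lamBdry g)) ^ 2) ≤
        (ENNReal.ofReal (1 + ε) * energyΩ g φ +
          ENNReal.ofReal (1 + ε⁻¹) * poincareConst g * laplacianSq g φ) * (K * energyΩ g f) := by
    intro ε hε
    rw [sq_sub_mean_eq g hbdry.nonempty hφL hσ1 hσ hf, ENNReal.ofReal_mul (sq_nonneg _),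
      ← ENNReal.toReal_div, ← ENNReal.toReal_pow, ENNReal.ofReal_toReal hKt]
    refine (mul_le_mul_right (ofReal_add_sq_le _ _ hε) K).trans ?_
    refine (mul_le_mul_right (add_le_add (mul_le_mul_right ha _) (mul_le_mul_right hb _)) K).trans
      (le_of_eq ?_)
    ring
  rw [mul_comm K, mul_assoc]
  -- Dividing by `K * energyΩ g f`, positive and finite, brings the estimate under the infimum over
  -- ε. If the energy is zero, any single ε, here 1, shows that the left side vanishes.
  by_cases hE0 : energyΩ g f = 0
  · refine (key 1 (mem_Ioi.2 one_pos)).trans ?_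
    rw [hE0, mul_zero, mul_zero]
    exact zero_le
  have hc0 : K * energyΩ g f ≠ 0 := mul_ne_zero hK0 hE0
  have hct : K * energyΩ g f ≠ ⊤ := ENNReal.mul_ne_top hKt hE
  rw [← ENNReal.div_le_iff hc0 hct]
  refine le_iInf₂ fun ε hε => ?_
  rw [ENNReal.div_le_iff hc0 hct]
  exact key ε hε
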